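/- Let $M$ be a (finite-dimensional, Hausdorff, smooth) manifold and $\tau:E\to M$ a smooth real vector bundle of finite rank with dual $\pi:E^*\to M$. Let $E$ carry a skew-symmetric algebroid structure: a skew-symmetric $\mathbb R$-bilinear bracket $[\cdot,\cdot]$ on smooth sections and a smooth vector bundle morphism $\rho:E\to TM$ with $[X,fY]=f[X,Y]+\rho(X)(f)\,Y$. Notation. For a section $X$ let $\iota_X$ be the corresponding fibrewise linear function on $E^*$. Let $\Pi$ be the linear bivector field on $E^*$ with $\Pi(d\iota_X,d\iota_Y)=\iota_{[X,Y]}$, $\Pi(d\iota_X,d(f\circ\pi))=\rho(X)(f)\circ\pi$, $\Pi(d(f\circ\pi),d(g\circ\pi))=0$; let $\widetilde\Pi:T^*E^*\to TE^*$ be contraction with $\Pi$, let $\mathcal R_E:T^*E\to T^*E^*$ be the canonical isomorphism, $(x,y,p,z)\mapsto(x,z,-p,y)$ in adapted coordinates, and put $\varepsilon=\widetilde\Pi\circ\mathcal R_E:T^*E\to TE^*$. For a manifold $Q$ let $\kappa_Q:TTQ\to TTQ$ be the canonical involution and $\alpha_Q:TT^*Q\to T^*TQ$ the canonical isomorphism.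 The *tangent lift algebroid* $d_TE$ is the structure on $T\tau:TE\to TM$ (with dual $T\pi:TE^*\to TM$) given by the bivector field $d_T\Pi$ on $TE^*$, $\widetilde{d_T\Pi}=\kappa_{E^*}\circ T\widetilde\Pi\circ\alpha_{E^*}^{-1}$; its morphism is $d_T\varepsilon=\widetilde{d_T\Pi}\circ\mathcal R_{TE}:T^*TE\to TTE^*$, where $\mathcal R_{TE}$ is the canonical isomorphism for the bundle $T\tau$. The tangent lift of a function $f$ on $Q$ is $d_Tf:TQ\to\mathbb R$, $d_Tf(u)=\langle df,u\rangle$. For a smooth Lagrangian $L:E\to\mathbb R$ put $\Lambda_L=\varepsilon\circ dL:E\to TE^*$ and $\lambda_L=\tau_{E^*}\circ\Lambda_L:E\to E^*$. A curve $\gamma:[t_0,t_1]\to E$ ($t_0<t_1$) solves the Euler–Lagrange (EL) equation of $(E,L)$ if $\lambda_L\circ\gamma$ is differentiable and $\frac{d}{dt}\lambda_L(\gamma(t))=\Lambda_L(\gamma(t))$ on $[t_0,t_1]$. The EL equation of $(d_TE,d_TL)$, for curves in $TE$, is the same equation with $d_T\varepsilon$ and $d_TL$ in place of $\varepsilon$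 and $L$. The tangent prolongation of the EL equation of $(E,L)$ is the equation $$\frac{d}{dt}\,T\lambda_L(J(t))=\kappa_{E^*}\bigl(T\Lambda_L(J(t))\bigr)\qquad(*)$$ for a curve $J:[t_0,t_1]\to TE$. Let $\kappa\subset TE\times TE$ be the relation dual to $\varepsilon$: it consists of the pairs $(X,Y)$ with $\rho(\tau_E(Y))=T\tau(X)$ and $\langle X,\varepsilon(A)\rangle_{T\tau}=\langle A,Y\rangle$ for all $A\in T^*_{\tau_E(Y)}E$, where $\langle\cdot,\cdot\rangle_{T\tau}:TE\times_{TM}TE^*\to\mathbb R$ is the tangent of the pairing of $E$ and $E^*$. If $\gamma$ solves the EL equation of $(E,L)$ and $\eta:[t_0,t_1]\to E$ is a differentiable curve with $\tau\circ\eta=\tau\circ\gamma$, the admissible variation $\delta_\eta\gamma$ is the vector field in $TE$ along $\gamma$ that is $\kappa$-related to $\dot\eta$, i.e. $\delta_\eta\gamma(t)\in T_{\gamma(t)}E$ and $(\dot\eta(t),\delta_\eta\gamma(t))\in\kappa$. The curve $\eta$ is a Jacobi vector field along $\gamma$ if $J=\delta_\eta\gamma$ satisfies $(*)$. **Theorem.**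 Let $L:E\to\mathbb R$ be a smooth Lagrangian on the skew-symmetric algebroid $E$ and $t_0<t_1$. 1. The tangent prolongation $(*)$ of the EL equation of $(E,L)$ is the EL equation of $(d_TE,d_TL)$: a curve $J:[t_0,t_1]\to TE$ satisfies $(*)$ if and only if it solves the EL equation of $(d_TE,d_TL)$. 2. Let $\gamma:[t_0,t_1]\to E$ solve the EL equation of $(E,L)$ and let $\eta:[t_0,t_1]\to E$ be a differentiable curve with $\tau\circ\eta=\tau\circ\gamma$. Then $\delta_\eta\gamma$ exists and is unique, and $\eta$ is a Jacobi vector field along $\gamma$ if and only if $\delta_\eta\gamma$ solves the EL equation of $(d_TE,d_TL)$. -/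

import Mathlib

open Bundle Set
open scoped Manifold ContDiff

noncomputable section

namespace SkewAlg

/-! ### Canonical objects on a manifold `Q`

Throughout, Mathlib's convention is used that a tangent vector at `q : Q` is its coordinate vector
in the preferred chart at `q`. The preferred charts of `TQ`, `T*Q`, `E`, `E*` at points lying over a
given base point are the ones induced by the preferred chart (and trivialization) at that base
point, so that the components of elements of the iterated bundles are their induced coordinates. -/

section Canonical

variable {W H : Type*} [NormedAddCommGroup W] [NormedSpace ℝ W] [TopologicalSpace H]
  (I : ModelWithCorners ℝ W H) (Q : Type*) [TopologicalSpace Q] [ChartedSpace H Q]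

/-- The cotangent bundle `T*Q`, as the bundle dual to the tangent bundle. -/
abbrev Cotangent : Type _ :=
  TotalSpace (W →L[ℝ] ℝ) (fun q : Q => TangentSpace I q →L[ℝ] Trivial Q ℝ q)

variable {Q}

/-- The differential of a function, as a map `Q → T*Q`. -/
def differential (f : Q → ℝ) (q : Q) : Cotangent I Q := ⟨q, mfderiv I 𝓘(ℝ, ℝ) f q⟩

/-- The tangent lift `d_T f : TQ → ℝ` of a function, the differential of `f` regarded as a
function on `TQ`. -/
def tangentLift (f : Q → ℝ) (u : TangentBundle I Q) : ℝ := mfderiv I 𝓘(ℝ, ℝ) f u.proj u.snd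

/-- The tangent prolongation at time `t` of a curve `c` defined on `s`, as an element of `TQ`. -/
def velocity (c : ℝ → Q) (s : Set ℝ) (t : ℝ) : TangentBundle I Q :=
  ⟨c t, mfderivWithin 𝓘(ℝ, ℝ) I c s t (1 : ℝ)⟩

variable (Q)
variable [IsManifold I ∞ Q]

/-- The canonical involution `κ_Q : TTQ → TTQ`, in induced coordinates
`(q, q̇, δq, δq̇) ↦ (q, δq, q̇, δq̇)`. -/
def kappa : TangentBundle I.tangent (TangentBundle I Q) →
    TangentBundle I.tangent (TangentBundle I Q) := fun A =>
  let w : W × W := A.snd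
  let v : W := A.proj.snd
  ⟨⟨A.proj.proj, w.1⟩, ((v, w.2) : W × W)⟩

/-- The canonical isomorphism `α_Q : TT*Q → T*TQ`, in induced coordinates
`(q, p, q̇, ṗ) ↦ (q, q̇, ṗ, p)`: the image of `(q, p, q̇, ṗ)` is the covector
`(δq, δq̇) ↦ ⟨ṗ, δq⟩ + ⟨p, δq̇⟩` at the point `(q, q̇)` of `TQ`. -/
def alpha : TangentBundle (I.prod 𝓘(ℝ, W →L[ℝ] ℝ)) (Cotangent I Q) ≃
    Cotangent I.tangent (TangentBundle I Q) where
  toFun Ψ :=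
    let w : W × (W →L[ℝ] ℝ) := Ψ.snd
    let p : W →L[ℝ] ℝ := Ψ.proj.snd
    ⟨⟨Ψ.proj.proj, w.1⟩, (w.2.coprod p : W × W →L[ℝ] ℝ)⟩
  invFun a :=
    let p : W × W →L[ℝ] ℝ := a.snd
    let v : W := a.proj.snd
    ⟨⟨a.proj.proj, p.comp (ContinuousLinearMap.inr ℝ W W)⟩,
      ((v, p.comp (ContinuousLinearMap.inl ℝ W W)) : W × (W →L[ℝ] ℝ))⟩
  left_inv Ψ := by
    obtain ⟨⟨q, p⟩, w⟩ := Ψ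
    have h₁ : ∀ f g : W →L[ℝ] ℝ, (f.coprod g).comp (ContinuousLinearMap.inr ℝ W W) = g :=
      fun f g => by ext; simp
    have h₂ : ∀ f g : W →L[ℝ] ℝ, (f.coprod g).comp (ContinuousLinearMap.inl ℝ W W) = f :=
      fun f g => by ext; simp
    refine congrArg₂ (fun (p' : W →L[ℝ] ℝ) (w' : W × (W →L[ℝ] ℝ)) => (⟨⟨q, p'⟩, w'⟩ :
      TangentBundle (I.prod 𝓘(ℝ, W →L[ℝ] ℝ)) (Cotangent I Q))) (h₁ _ _) (Prod.ext rfl (h₂ _ _))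
  right_inv a := by
    obtain ⟨⟨q, v⟩, p⟩ := a
    have h : ∀ f : W × W →L[ℝ] ℝ, (f.comp (ContinuousLinearMap.inl ℝ W W)).coprod
        (f.comp (ContinuousLinearMap.inr ℝ W W)) = f := fun f => by
      ext <;> simp
    exact congrArg (fun p' : W × W →L[ℝ] ℝ =>
      (⟨⟨q, v⟩, p'⟩ : Cotangent I.tangent (TangentBundle I Q))) (h _)

end Canonical

/-! ### Lagrangian dynamics of a morphism `ε : T*N → TN'` -/

section EulerLagrange

variable {W H W' H' : Type*} [NormedAddCommGroup W] [NormedSpace ℝ W] [TopologicalSpace H]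
  {I : ModelWithCorners ℝ W H} {N : Type*} [TopologicalSpace N] [ChartedSpace H N]
  [NormedAddCommGroup W'] [NormedSpace ℝ W'] [TopologicalSpace H']
  {I' : ModelWithCorners ℝ W' H'} {N' : Type*} [TopologicalSpace N'] [ChartedSpace H' N']
  (ε : Cotangent I N → TangentBundle I' N') (L : N → ℝ)

/-- The Tulczyjew differential `Λ_L = ε ∘ dL : N → TN'`. -/
def tulczyjew (v : N) : TangentBundle I' N' := ε (differential I L v)

/-- The Legendre mapping `λ_L = τ_{N'} ∘ ε ∘ dL : N → N'`. -/
def legendre (v : N) : N' := (tulczyjew ε L v).proj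

/-- The curve `γ : [t₀, t₁] → N` satisfies the Euler-Lagrange equation: `λ_L ∘ γ` is
differentiable and its tangent prolongation is `Λ_L ∘ γ`. -/
def IsELSolution (t₀ t₁ : ℝ) (γ : ℝ → N) : Prop :=
  ∀ t ∈ Icc t₀ t₁,
    MDifferentiableWithinAt 𝓘(ℝ, ℝ) I' (fun s => legendre ε L (γ s)) (Icc t₀ t₁) t ∧
    velocity I' (fun s => legendre ε L (γ s)) (Icc t₀ t₁) t = tulczyjew ε L (γ t)

/-- The curve `J : [t₀, t₁] → TN` satisfies the tangent prolongation
`d/dt (Tλ_L (J t)) = κ_{N'} (TΛ_L (J t))` of the Euler-Lagrange equation. -/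
def IsProlongedELSolution [IsManifold I' ∞ N'] (t₀ t₁ : ℝ) (J : ℝ → TangentBundle I N) : Prop :=
  ∀ t ∈ Icc t₀ t₁,
    MDifferentiableWithinAt 𝓘(ℝ, ℝ) I'.tangent
      (fun s => tangentMap I I' (legendre ε L) (J s)) (Icc t₀ t₁) t ∧
    velocity I'.tangent (fun s => tangentMap I I' (legendre ε L) (J s)) (Icc t₀ t₁) t =
      kappa I' N' (tangentMap I I'.tangent (tulczyjew ε L) (J t))

end EulerLagrange

/-! ### Skew-symmetric algebroids -/

section Algebroid

variable {B : Type*} [NormedAddCommGroup B] [NormedSpace ℝ B]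
  {M : Type*} [TopologicalSpace M] [ChartedSpace B M] [IsManifold 𝓘(ℝ, B) ∞ M]
  (F : Type*) [NormedAddCommGroup F] [NormedSpace ℝ F]
  (E : M → Type*) [∀ x, AddCommGroup (E x)] [∀ x, Module ℝ (E x)] [∀ x, TopologicalSpace (E x)]
  [TopologicalSpace (TotalSpace F E)] [FiberBundle F E] [VectorBundle ℝ F E]
  [ContMDiffVectorBundle ∞ F E 𝓘(ℝ, B)]

/-- The total space of the dual bundle `π : E* → M`. -/
abbrev DualBundle : Type _ :=
  TotalSpace (F →L[ℝ] ℝ) (fun x : M => E x →L[ℝ] Trivial M ℝ x)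

/-- The model with corners of the manifold `E`. -/
abbrev modelE (B F : Type*) [NormedAddCommGroup B] [NormedSpace ℝ B] [NormedAddCommGroup F]
    [NormedSpace ℝ F] : ModelWithCorners ℝ (B × F) (ModelProd B F) := 𝓘(ℝ, B).prod 𝓘(ℝ, F)

/-- The model with corners of the manifold `E*`. -/
abbrev modelDual (B F : Type*) [NormedAddCommGroup B] [NormedSpace ℝ B] [NormedAddCommGroup F]
    [NormedSpace ℝ F] : ModelWithCorners ℝ (B × (F →L[ℝ] ℝ)) (ModelProd B (F →L[ℝ] ℝ)) :=
  𝓘(ℝ, B).prod 𝓘(ℝ, F →L[ℝ] ℝ)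

/-- A skew-symmetric algebroid structure on the vector bundle `E → M`. -/
structure SkewAlgebroid where
  /-- the bracket on the smooth sections of `E` -/
  bracket : ContMDiffSection 𝓘(ℝ, B) F ∞ E →ₗ[ℝ] ContMDiffSection 𝓘(ℝ, B) F ∞ E →ₗ[ℝ]
    ContMDiffSection 𝓘(ℝ, B) F ∞ E
  /-- the anchor map -/
  anchor : ∀ x : M, E x →L[ℝ] TangentSpace 𝓘(ℝ, B) x
  contMDiff_anchor : ContMDiff (modelE B F) 𝓘(ℝ, B).tangent ∞
    (fun v : TotalSpace F E => (⟨v.proj, anchor v.proj v.snd⟩ : TangentBundle 𝓘(ℝ, B) M))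
  skew : ∀ X Y, bracket X Y = -bracket Y X
  leibniz : ∀ (X Y Z : ContMDiffSection 𝓘(ℝ, B) F ∞ E) (f : M → ℝ), ContMDiff 𝓘(ℝ, B) 𝓘(ℝ, ℝ) ∞ f →
    (∀ x, Z x = f x • Y x) → ∀ x,
      bracket X Z x = f x • bracket X Y x + tangentLift 𝓘(ℝ, B) f ⟨x, anchor x (X x)⟩ • Y x

variable {F E}

/-- The coordinate in `F` of a point `v : E`, in the preferred trivialization at its base point. -/
def fibreCoord (v : TotalSpace F E) : F := (trivializationAt F E v.proj v).2

/-- The coordinate in `F*` of a point `z : E*`, in the preferred trivialization at its base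
point. -/
def dualCoord (z : DualBundle F E) : F →L[ℝ] ℝ :=
  (trivializationAt (F →L[ℝ] ℝ) (fun x : M => E x →L[ℝ] Trivial M ℝ x) z.proj z).2

/-- The natural pairing `⟨u, w⟩_{Tτ}` between `Tτ : TE → TM` and `Tπ : TE* → TM`, for `u` and `w`
over the same tangent vector of `M`. It is the derivative of the pairing of `E` and `E*`:
`⟨(x, y, ẋ, ẏ), (x, z, ẋ, ż)⟩ = z ẏ + ż y`. -/
def tangentPairing (u : TangentBundle (modelE B F) (TotalSpace F E))
    (w : TangentBundle (modelDual B F) (DualBundle F E)) : ℝ :=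
  let u' : B × F := u.snd
  let w' : B × (F →L[ℝ] ℝ) := w.snd
  dualCoord w.proj u'.2 + w'.2 (fibreCoord u.proj)

/-- The canonical isomorphism `R_E : T*E → T*E*`, in coordinates `(x, y, p, z) ↦ (x, z, -p, y)`.
Intrinsically, `A` at `v` is sent to the point `z` of `E*` given by the restriction of `A` to vertical
vectors, and `⟨R_E A, w⟩ + ⟨A, u⟩ = ⟨u, w⟩_{Tτ}` for `u` at `v` and `w` at `z` with `Tτ u = Tπ w`. -/
def dualityE (A : Cotangent (modelE B F) (TotalSpace F E)) :
    Cotangent (modelDual B F) (DualBundle F E) :=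
  let a : B × F →L[ℝ] ℝ := A.snd
  let p : B →L[ℝ] ℝ := a.comp (ContinuousLinearMap.inl ℝ B F)
  let z : F →L[ℝ] ℝ := a.comp (ContinuousLinearMap.inr ℝ B F)
  ⟨⟨A.proj.proj, z.comp ((trivializationAt F E A.proj.proj).continuousLinearMapAt ℝ A.proj.proj)⟩,
    ((-p).coprod (ContinuousLinearMap.apply ℝ ℝ (fibreCoord A.proj)) :
      B × (F →L[ℝ] ℝ) →L[ℝ] ℝ)⟩

/-- The canonical isomorphism `R_{TE} : T*TE → T*TE*` of the vector bundle `Tτ : TE → TM`, whose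
dual is `Tπ : TE* → TM`. Over the base point `(x, ẋ)`, the fibre coordinates are `(y, ẏ)` on `TE`
and, by the formula for `⟨·, ·⟩_{Tτ}`, the dual ones are `(ż, z)` on `TE*`. Hence the covector with
components `(p, r, p', r')` on `(δx, δy, δẋ, δẏ)` at `(x, y, ẋ, ẏ)` is sent to the point
`(x, z, ẋ, ż) = (x, r', ẋ, r)` and the covector with components `(-p, ẏ, -p', y)` on
`(δx, δz, δẋ, δż)`. -/
def dualityTE (A : Cotangent (modelE B F).tangent (TangentBundle (modelE B F) (TotalSpace F E))) :
    Cotangent (modelDual B F).tangent (TangentBundle (modelDual B F) (DualBundle F E)) :=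
  let a : (B × F) × (B × F) →L[ℝ] ℝ := A.snd
  let c : B × F →L[ℝ] ℝ := a.comp (ContinuousLinearMap.inl ℝ (B × F) (B × F))
  let c' : B × F →L[ℝ] ℝ := a.comp (ContinuousLinearMap.inr ℝ (B × F) (B × F))
  let p : B →L[ℝ] ℝ := c.comp (ContinuousLinearMap.inl ℝ B F)
  let r : F →L[ℝ] ℝ := c.comp (ContinuousLinearMap.inr ℝ B F)
  let p' : B →L[ℝ] ℝ := c'.comp (ContinuousLinearMap.inl ℝ B F)
  let r' : F →L[ℝ] ℝ := c'.comp (ContinuousLinearMap.inr ℝ B F)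
  let x : M := A.proj.proj.proj
  let y : F := fibreCoord A.proj.proj
  let dv : B × F := A.proj.snd
  ⟨⟨⟨x, r'.comp ((trivializationAt F E x).continuousLinearMapAt ℝ x)⟩,
      ((dv.1, r) : B × (F →L[ℝ] ℝ))⟩,
    (((-p).coprod (ContinuousLinearMap.apply ℝ ℝ dv.2)).coprod
      ((-p').coprod (ContinuousLinearMap.apply ℝ ℝ y)) :
        (B × (F →L[ℝ] ℝ)) × (B × (F →L[ℝ] ℝ)) →L[ℝ] ℝ)⟩

namespace SkewAlgebroid

variable (𝔸 : SkewAlgebroid (B := B) F E)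

/-- The anchor `ρ : E → TM` as a map of total spaces. -/
def rho (v : TotalSpace F E) : TangentBundle 𝓘(ℝ, B) M := ⟨v.proj, 𝔸.anchor v.proj v.snd⟩

/-- The function `ι_X : E* → ℝ`, linear on the fibres, given by a section `X` of `E`. -/
def linearFunction (X : ContMDiffSection 𝓘(ℝ, B) F ∞ E) (z : DualBundle F E) : ℝ :=
  z.snd (X z.proj)

/-- `w` is the contraction with the covector `ψ` of the linear bivector field `Π` on `E*`
determined by `Π(dι_X, dι_Y) = ι_[X,Y]`, `Π(dι_X, d(f ∘ π)) = ρ(X)(f) ∘ π`,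
`Π(d(f ∘ π), d(g ∘ π)) = 0`: whenever `ψ = d(ι_X + f ∘ π)` at the point `z`, then
`⟨d(g ∘ π), w⟩ = ρ(X)(g)`, i.e. `Tπ w = ρ(X)`, and `⟨dι_Y, w⟩ = ⟨z, [X, Y]⟩ - ρ(Y)(f)`. -/
def IsContraction (ψ : Cotangent (modelDual B F) (DualBundle F E))
    (w : TangentSpace (modelDual B F) ψ.proj) : Prop :=
  ∀ (X : ContMDiffSection 𝓘(ℝ, B) F ∞ E) (f : M → ℝ), ContMDiff 𝓘(ℝ, B) 𝓘(ℝ, ℝ) ∞ f →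
    differential (modelDual B F) (fun z : DualBundle F E => linearFunction X z + f z.proj) ψ.proj
      = ψ →
    mfderiv (modelDual B F) 𝓘(ℝ, B) (fun z : DualBundle F E => z.proj) ψ.proj w =
      𝔸.anchor ψ.proj.proj (X ψ.proj.proj) ∧
    ∀ Y : ContMDiffSection 𝓘(ℝ, B) F ∞ E,
      tangentLift (modelDual B F) (linearFunction Y : DualBundle F E → ℝ) ⟨ψ.proj, w⟩ =
        linearFunction (𝔸.bracket X Y) ψ.proj -
          tangentLift 𝓘(ℝ, B) f ⟨ψ.proj.proj, 𝔸.anchor ψ.proj.proj (Y ψ.proj.proj)⟩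

/-- The morphism `Π̃ : T*E* → TE*`: contraction with the linear bivector field `Π` on `E*`, i.e. the
unique vector satisfying `IsContraction`. -/
def sharp (ψ : Cotangent (modelDual B F) (DualBundle F E)) :
    TangentBundle (modelDual B F) (DualBundle F E) :=
  ⟨ψ.proj, Classical.epsilon (𝔸.IsContraction ψ)⟩

/-- The morphism `ε = Π̃ ∘ R_E : T*E → TE*`. -/
def eps (A : Cotangent (modelE B F) (TotalSpace F E)) :
    TangentBundle (modelDual B F) (DualBundle F E) := 𝔸.sharp (dualityE A)

/-- The relation `κ ⊂ TE × TE` dual to `ε`. -/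
def KappaRel (X Y : TangentBundle (modelE B F) (TotalSpace F E)) : Prop :=
  𝔸.rho Y.proj = tangentMap (modelE B F) 𝓘(ℝ, B) (fun v : TotalSpace F E => v.proj) X ∧
  ∀ A : TangentSpace (modelE B F) Y.proj →L[ℝ] ℝ,
    tangentPairing X (𝔸.eps ⟨Y.proj, A⟩) = A Y.snd

/-- The infinitesimal admissible variation `δ_ξ γ` of `γ` generated by `ξ`, for curves on `s`: the
unique vector field in `TE` along `γ` that is `κ`-related to the tangent prolongation of `ξ`. -/
def admissibleVariation (s : Set ℝ) (γ ξ : ℝ → TotalSpace F E) (t : ℝ) :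
    TangentBundle (modelE B F) (TotalSpace F E) :=
  ⟨γ t, Classical.epsilon fun Y : TangentSpace (modelE B F) (γ t) =>
    𝔸.KappaRel (velocity (modelE B F) ξ s t) ⟨γ t, Y⟩⟩

/-- The tangent lift `d_T Π` of the bivector field `Π`, as the morphism
`κ_{E*} ∘ TΠ̃ ∘ α_{E*}⁻¹ : T*TE* → TTE*`. It defines the tangent lift algebroid `d_T E`. -/
def liftSharp (Φ : Cotangent (modelDual B F).tangent
      (TangentBundle (modelDual B F) (DualBundle F E))) :
    TangentBundle (modelDual B F).tangent (TangentBundle (modelDual B F) (DualBundle F E)) :=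
  kappa (modelDual B F) (DualBundle F E)
    (tangentMap ((modelDual B F).prod 𝓘(ℝ, (B × (F →L[ℝ] ℝ)) →L[ℝ] ℝ)) (modelDual B F).tangent
      𝔸.sharp ((alpha (modelDual B F) (DualBundle F E)).symm Φ))

/-- The morphism `d_T ε : T*TE → TTE*` of the tangent lift algebroid `d_T E`. -/
def liftEps (A : Cotangent (modelE B F).tangent
      (TangentBundle (modelE B F) (TotalSpace F E))) :
    TangentBundle (modelDual B F).tangent (TangentBundle (modelDual B F) (DualBundle F E)) :=
  𝔸.liftSharp (dualityTE A)

/-- `η` is a Jacobi vector field along the solution `γ` of the Euler-Lagrange equation: a curve in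
`E` over the same base path whose admissible variation satisfies the Jacobi equation. -/
def IsJacobiField (L : TotalSpace F E → ℝ) (t₀ t₁ : ℝ) (γ η : ℝ → TotalSpace F E) : Prop :=
  (∀ t ∈ Icc t₀ t₁, (η t).proj = (γ t).proj) ∧
  MDifferentiableOn 𝓘(ℝ, ℝ) (modelE B F) η (Icc t₀ t₁) ∧
  IsProlongedELSolution 𝔸.eps L t₀ t₁ (𝔸.admissibleVariation (Icc t₀ t₁) γ η)

end SkewAlgebroid

end Algebroid

end SkewAlg

end

noncomputable section

set_option linter.unusedSectionVars false

namespace SkewAlg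

open Filter Topology

/-! By definition $\Lambda_L=\widetilde\Pi\circ(\mathcal R_E\circ dL)$, where $\mathcal R_E\circ dL$
is `dualDifferential`. The heart of the matter is the identity $T(\mathcal R_E\circ
dL)=\alpha^{-1}\circ\mathcal R_{TE}\circ d(d_TL)$ (`tangentMap_dualDifferential`), which in induced
coordinates is the symmetry of the second derivative of $L$. Composing with $\kappa\circ
T\widetilde\Pi$ and using the chain rule gives $\kappa\circ T\Lambda_L=\Lambda_{d_TL}$
(`kappa_tangentMap_tulczyjew`). As $\kappa$ interchanges the two projections $TTE^*\to TE^*$,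
projecting gives $T\lambda_L=\lambda_{d_TL}$ (`tangentMap_legendre`). The two equations for $J$ thus
have the same left and right sides.

The chain rule requires $\widetilde\Pi$ to be differentiable. Since `sharp` picks a vector with a
certain property, existence, uniqueness and smoothness of that vector must be established. A
covector on $E^*$ is $d(\iota_X+f\circ\pi)$ with $X$ locally constant in a trivialization and $f$
locally linear in a chart, both cut off to global objects. The Leibniz rule and skew-symmetry
express $[X,Y]$ at a point through the values and first derivatives of $X$, $Y$ and the brackets of
frame sections (`components_bracket`), so the contraction does not depend on the choice of $X$ and
$f$. The same computation at points near a fixed one gives `contMDiff_sharp`.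

For the admissible variation, $A\mapsto\langle X,\varepsilon(A)\rangle$ is a linear form on
$T^*_vE$, hence evaluation at exactly one vector of $T_vE$. The anchor condition in $\kappa$ does
not involve that vector. It holds because $T\pi\circ\Lambda_L=\rho$, so that the EL equation makes
$\rho\circ\gamma$ the velocity of the base path, which $\eta$ shares. -/

/-- The coordinates of an element of a dual bundle, evaluated on a coordinate vector. -/
theorem trivializationAt_dual_snd_apply {M F : Type*} [TopologicalSpace M] [NormedAddCommGroup F]
    [NormedSpace ℝ F] {E : M → Type*} [∀ x, AddCommGroup (E x)] [∀ x, Module ℝ (E x)]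
    [∀ x, TopologicalSpace (E x)] [TopologicalSpace (TotalSpace F E)] [FiberBundle F E]
    [VectorBundle ℝ F E] (x₀ : M)
    (z : TotalSpace (F →L[ℝ] ℝ) (fun x : M => E x →L[ℝ] Trivial M ℝ x)) (y : F) :
    (trivializationAt (F →L[ℝ] ℝ) (fun x : M => E x →L[ℝ] Trivial M ℝ x) x₀ z).2 y =
      z.snd ((trivializationAt F E x₀).symmL ℝ z.proj y) :=
  DFunLike.congr_fun (Trivial.continuousLinearMapAt_trivialization ℝ M ℝ z.proj)
    (z.snd ((trivializationAt F E x₀).symmL ℝ z.proj y))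

/-! ### Derivatives of functions in the preferred charts of a manifold. -/

section Charts

variable {W H : Type*} [NormedAddCommGroup W] [NormedSpace ℝ W] [TopologicalSpace H]
  {I : ModelWithCorners ℝ W H} [I.Boundaryless] {Q : Type*} [TopologicalSpace Q] [ChartedSpace H Q]

/-- The differential of a function at the centre of a chart is the derivative of its coordinate
representation. -/
theorem mfderiv_eq_fderiv_comp_extChartAt_symm {G : Type*} [NormedAddCommGroup G] [NormedSpace ℝ G]
    {f : Q → G} {q : Q} (hf : MDifferentiableAt I 𝓘(ℝ, G) f q) :
    mfderiv I 𝓘(ℝ, G) f q = fderiv ℝ (f ∘ (extChartAt I q).symm) (extChartAt I q q) := by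
  rw [hf.mfderiv, I.range_eq_univ, fderivWithin_univ]
  rfl

variable [IsManifold I ∞ Q]

theorem mdifferentiableAt_extChartAt_symm {q₀ : Q} {ξ : W} (hξ : ξ ∈ (extChartAt I q₀).target) :
    MDifferentiableAt 𝓘(ℝ, W) I (extChartAt I q₀).symm ξ := by
  have : IsManifold I 1 Q := IsManifold.of_le (n := ∞) (by simp)
  have h := mdifferentiableWithinAt_extChartAt_symm (I := I) hξ
  rwa [I.range_eq_univ, mdifferentiableWithinAt_univ] at h

theorem differentiableAt_comp_extChartAt_symm {G : Type*} [NormedAddCommGroup G] [NormedSpace ℝ G]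
    {f : Q → G} {q₀ q : Q} (hq : q ∈ (chartAt H q₀).source) (hf : MDifferentiableAt I 𝓘(ℝ, G) f q) :
    DifferentiableAt ℝ (f ∘ (extChartAt I q₀).symm) (extChartAt I q₀ q) := by
  rw [← mdifferentiableAt_iff_differentiableAt]
  have hq' : q ∈ (extChartAt I q₀).source := by rwa [extChartAt_source]
  refine MDifferentiableAt.comp (I' := I) _ ?_
    (mdifferentiableAt_extChartAt_symm ((extChartAt I q₀).map_source hq'))
  rwa [(extChartAt I q₀).left_inv hq']

/-- The differential of a function, expressed in an arbitrary preferred chart. -/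
theorem mfderiv_apply_eq_fderiv {G : Type*} [NormedAddCommGroup G] [NormedSpace ℝ G]
    {f : Q → G} {q₀ q : Q} (hq : q ∈ (chartAt H q₀).source) (hf : MDifferentiableAt I 𝓘(ℝ, G) f q)
    (w : TangentSpace I q) :
    mfderiv I 𝓘(ℝ, G) f q w = fderiv ℝ (f ∘ (extChartAt I q₀).symm) (extChartAt I q₀ q)
      (mfderiv I 𝓘(ℝ, W) (extChartAt I q₀) q w) := by
  have : IsManifold I 1 Q := IsManifold.of_le (n := ∞) (by simp)
  have hq' : q ∈ (extChartAt I q₀).source := by rwa [extChartAt_source]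
  have h1 : f =ᶠ[𝓝 q] (f ∘ (extChartAt I q₀).symm) ∘ extChartAt I q₀ := by
    filter_upwards [(isOpen_extChartAt_source (I := I) q₀).mem_nhds hq'] with x hx
    exact congrArg f ((extChartAt I q₀).left_inv hx).symm
  rw [h1.mfderiv_eq, mfderiv_comp (I' := 𝓘(ℝ, W)) q
    (differentiableAt_comp_extChartAt_symm hq hf).mdifferentiableAt
    (mdifferentiableAt_extChartAt hq), mfderiv_eq_fderiv]
  rfl

theorem trivializationAt_tangent_snd {q₀ : Q} {u : TangentBundle I Q}
    (hq : u.proj ∈ (chartAt H q₀).source) :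
    (trivializationAt W (TangentSpace I) q₀ u).2 =
      mfderiv I 𝓘(ℝ, W) (extChartAt I q₀) u.proj u.snd := by
  have : IsManifold I 1 Q := IsManifold.of_le (n := ∞) (by simp)
  have hb : u.proj ∈ (trivializationAt W (TangentSpace I) q₀).baseSet := by simpa using hq
  exact (congrFun (Trivialization.coe_linearMapAt_of_mem (R := ℝ) _ hb) u.snd).symm.trans
    (DFunLike.congr_fun (TangentBundle.continuousLinearMapAt_trivializationAt hq) u.snd)

/-- The tangent lift of a function in the induced coordinates. -/
theorem tangentLift_eq_fderiv {f : Q → ℝ} {q₀ : Q} {u : TangentBundle I Q}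
    (hq : u.proj ∈ (chartAt H q₀).source) (hf : MDifferentiableAt I 𝓘(ℝ, ℝ) f u.proj) :
    tangentLift I f u = fderiv ℝ (f ∘ (extChartAt I q₀).symm) (extChartAt I q₀ u.proj)
      (trivializationAt W (TangentSpace I) q₀ u).2 := by
  rw [trivializationAt_tangent_snd hq]
  exact mfderiv_apply_eq_fderiv hq hf _

/-- The differential of a function in the induced coordinates of the cotangent bundle. -/
theorem trivializationAt_differential_snd {f : Q → ℝ} {q₀ q : Q}
    (hq : q ∈ (chartAt H q₀).source) (hf : MDifferentiableAt I 𝓘(ℝ, ℝ) f q) :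
    (trivializationAt (W →L[ℝ] ℝ) (fun q : Q => TangentSpace I q →L[ℝ] Trivial Q ℝ q) q₀
      (differential I f q)).2 =
      fderiv ℝ (f ∘ (extChartAt I q₀).symm) (extChartAt I q₀ q) := by
  have : IsManifold I 1 Q := IsManifold.of_le (n := ∞) (by simp)
  ext w
  have hb : q ∈ (trivializationAt W (TangentSpace I) q₀).baseSet := by simpa using hq
  have h0 := TangentBundle.continuousLinearMapAt_trivializationAt (I := I) hq
  have h1 : mfderiv I 𝓘(ℝ, W) (extChartAt I q₀) q
      ((trivializationAt W (TangentSpace I) q₀).symmL ℝ q w) = w :=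
    (DFunLike.congr_fun h0.symm _).trans
      (Trivialization.continuousLinearMapAt_symmL (R := ℝ) _ hb w)
  rw [trivializationAt_dual_snd_apply]
  exact (mfderiv_apply_eq_fderiv hq hf _).trans (congrArg _ h1)

end Charts

/-! ### Charts of the total space of a vector bundle. -/

section BundleCharts

variable {W H : Type*} [NormedAddCommGroup W] [NormedSpace ℝ W] [TopologicalSpace H]
  {I : ModelWithCorners ℝ W H} {Q : Type*} [TopologicalSpace Q] [ChartedSpace H Q]
  {F : Type*} [NormedAddCommGroup F] [NormedSpace ℝ F]
  {E : Q → Type*} [∀ x, AddCommGroup (E x)] [∀ x, Module ℝ (E x)] [∀ x, TopologicalSpace (E x)]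
  [TopologicalSpace (TotalSpace F E)] [FiberBundle F E] [VectorBundle ℝ F E]

theorem mem_chartAt_totalSpace_source (v₀ v : TotalSpace F E) :
    v ∈ (chartAt (ModelProd H F) v₀).source ↔
      v.proj ∈ (trivializationAt F E v₀.proj).baseSet ∧ v.proj ∈ (chartAt H v₀.proj).source := by
  rw [FiberBundle.chartedSpace_chartAt]
  simp only [mfld_simps]
  constructor
  · rintro ⟨h1, h2⟩
    rw [Trivialization.coe_fst _ h1] at h2
    exact ⟨(Trivialization.mem_source _).1 h1, h2⟩
  · rintro ⟨h1, h2⟩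
    rw [Trivialization.coe_fst' _ h1]
    exact ⟨(Trivialization.mem_source _).2 h1, h2⟩

theorem extChartAt_totalSpace_apply {v₀ v : TotalSpace F E}
    (hv : v.proj ∈ (trivializationAt F E v₀.proj).baseSet) :
    extChartAt (I.prod 𝓘(ℝ, F)) v₀ v =
      (extChartAt I v₀.proj v.proj, (trivializationAt F E v₀.proj v).2) := by
  rw [FiberBundle.extChartAt]
  simp only [mfld_simps]
  rw [Trivialization.coe_fst' _ hv]

theorem extChartAt_totalSpace_symm_apply {v₀ : TotalSpace F E} {p : W × F}
    (hv : (extChartAt I v₀.proj).symm p.1 ∈ (trivializationAt F E v₀.proj).baseSet) :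
    (extChartAt (I.prod 𝓘(ℝ, F)) v₀).symm p =
      ⟨(extChartAt I v₀.proj).symm p.1,
        (trivializationAt F E v₀.proj).symmL ℝ ((extChartAt I v₀.proj).symm p.1) p.2⟩ := by
  rw [Trivialization.symmL_apply _ hv, Trivialization.mk_symm _ hv, FiberBundle.extChartAt]
  rfl

end BundleCharts

variable {B : Type*} [NormedAddCommGroup B] [NormedSpace ℝ B]
  {M : Type*} [TopologicalSpace M] [ChartedSpace B M] [IsManifold 𝓘(ℝ, B) ∞ M]
  {F : Type*} [NormedAddCommGroup F] [NormedSpace ℝ F]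
  {E : M → Type*} [∀ x, AddCommGroup (E x)] [∀ x, Module ℝ (E x)] [∀ x, TopologicalSpace (E x)]
  [TopologicalSpace (TotalSpace F E)] [FiberBundle F E] [VectorBundle ℝ F E]
  [ContMDiffVectorBundle ∞ F E 𝓘(ℝ, B)]

/-! ### Cutoff functions, and global sections constant near a point. -/

section Cutoff

variable [FiniteDimensional ℝ B] [T2Space M]

variable (F E) in
-- The bracket takes global sections, so local frames have to be extended by zero. For this the
-- closed support must lie in the trivialization domain.
theorem exists_cutoff (x₀ : M) : ∃ χ : SmoothBumpFunction 𝓘(ℝ, B) x₀,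
    tsupport χ ⊆ (trivializationAt F E x₀).baseSet := by
  obtain ⟨χ, -, h⟩ := (SmoothBumpFunction.nhds_basis_tsupport (I := 𝓘(ℝ, B)) x₀).mem_iff.1
    ((trivializationAt F E x₀).open_baseSet.mem_nhds (mem_baseSet_trivializationAt F E x₀))
  exact ⟨χ, h⟩

variable (F E) in
/-- A smooth bump function at `x₀` supported in the domains of the preferred chart and of the
preferred trivialization at `x₀`. -/
def cutoff (x₀ : M) : SmoothBumpFunction 𝓘(ℝ, B) x₀ := (exists_cutoff F E x₀).choose

variable (F E) in
/-- The points at which the cutoff function at `x₀` is locally equal to `1`, in the domains of the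
preferred chart and of the preferred trivialization at `x₀`. -/
structure IsCutoffPoint (x₀ x : M) : Prop where
  cutoff_eq_one : ∀ᶠ x' in 𝓝 x, cutoff (B := B) F E x₀ x' = 1
  mem_baseSet : x ∈ (trivializationAt F E x₀).baseSet
  mem_source : x ∈ (chartAt B x₀).source

variable (F E) in
theorem eventually_isCutoffPoint (x₀ : M) : ∀ᶠ x in 𝓝 x₀, IsCutoffPoint (B := B) F E x₀ x := by
  filter_upwards [(cutoff (B := B) F E x₀).eventuallyEq_one.eventually_nhds,
    (trivializationAt F E x₀).open_baseSet.mem_nhds (mem_baseSet_trivializationAt F E x₀),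
    (chartAt B x₀).open_source.mem_nhds (mem_chart_source B x₀)] with x h1 h2 h3
  exact ⟨h1, h2, h3⟩

variable (F E) in
theorem isCutoffPoint_self (x₀ : M) : IsCutoffPoint (B := B) F E x₀ x₀ :=
  (eventually_isCutoffPoint F E x₀).self_of_nhds

variable (F E) in
/-- The product of the cutoff function at `x₀` with the coordinate expression `p` of a function. -/
def cutoffLinear (x₀ : M) (p : B →L[ℝ] ℝ) (x : M) : ℝ :=
  cutoff (B := B) F E x₀ x • p (extChartAt 𝓘(ℝ, B) x₀ x)

theorem contMDiff_cutoffLinear (x₀ : M) (p : B →L[ℝ] ℝ) :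
    ContMDiff 𝓘(ℝ, B) 𝓘(ℝ, ℝ) ∞ (cutoffLinear F E x₀ p) :=
  SmoothBumpFunction.contMDiff_smul _
    (p.contDiff.contMDiff.comp_contMDiffOn contMDiffOn_extChartAt)

theorem IsCutoffPoint.cutoffLinear_eventuallyEq {x₀ x : M} (h : IsCutoffPoint (B := B) F E x₀ x)
    (p : B →L[ℝ] ℝ) : cutoffLinear F E x₀ p =ᶠ[𝓝 x] fun x' => p (extChartAt 𝓘(ℝ, B) x₀ x') := by
  filter_upwards [h.cutoff_eq_one] with x' hx'
  simp [cutoffLinear, hx']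

variable (F E) in
/-- The global sections which, near `x₀`, are constant in the preferred trivialization at `x₀`. -/
def frame (x₀ : M) : F →ₗ[ℝ] ContMDiffSection 𝓘(ℝ, B) F ∞ E where
  toFun Y := ⟨fun x => cutoff (B := B) F E x₀ x • (trivializationAt F E x₀).symmL ℝ x Y, by
    refine ContMDiffOn.smul_section_of_tsupport (cutoff F E x₀).contMDiff.contMDiffOn
      (trivializationAt F E x₀).open_baseSet (exists_cutoff F E x₀).choose_spec ?_
    rw [(trivializationAt F E x₀).contMDiffOn_section_baseSet_iff]
    refine (contMDiffOn_const (c := Y)).congr fun x hx => ?_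
    rw [Trivialization.symmL_apply _ hx, Trivialization.apply_mk_symm _ hx]⟩
  map_add' Y Z := by
    ext x
    simp
  map_smul' c Y := by
    ext x
    simp [smul_comm c]

theorem frame_apply (x₀ : M) (Y : F) (x : M) : frame (B := B) F E x₀ Y x =
    cutoff (B := B) F E x₀ x • (trivializationAt F E x₀).symmL ℝ x Y := rfl

theorem IsCutoffPoint.frame_eq {x₀ x : M} (h : IsCutoffPoint (B := B) F E x₀ x) (Y : F) :
    frame (B := B) F E x₀ Y x = (trivializationAt F E x₀).symmL ℝ x Y := by
  rw [frame_apply, h.cutoff_eq_one.self_of_nhds, one_smul]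

end Cutoff

/-- The components of a section in the preferred trivialization at `x₀`. -/
def components (x₀ : M) (X : ContMDiffSection 𝓘(ℝ, B) F ∞ E) (x : M) : F :=
  (trivializationAt F E x₀).continuousLinearMapAt ℝ x (X x)

theorem symmL_components {x₀ x : M} (h : x ∈ (trivializationAt F E x₀).baseSet)
    (X : ContMDiffSection 𝓘(ℝ, B) F ∞ E) :
    (trivializationAt F E x₀).symmL ℝ x (components x₀ X x) = X x :=
  Trivialization.symmL_continuousLinearMapAt _ h _

theorem contMDiffOn_components (x₀ : M) (X : ContMDiffSection 𝓘(ℝ, B) F ∞ E) :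
    ContMDiffOn 𝓘(ℝ, B) 𝓘(ℝ, F) ∞ (components x₀ X) (trivializationAt F E x₀).baseSet := by
  have h := (trivializationAt F E x₀).contMDiffOn_section_baseSet_iff.1
    (X.contMDiff.contMDiffOn (s := (trivializationAt F E x₀).baseSet))
  refine h.congr fun x hx => ?_
  exact congrFun (Trivialization.coe_linearMapAt_of_mem _ hx) _

theorem mdifferentiableAt_components {x₀ x : M} (h : x ∈ (trivializationAt F E x₀).baseSet)
    (X : ContMDiffSection 𝓘(ℝ, B) F ∞ E) :
    MDifferentiableAt 𝓘(ℝ, B) 𝓘(ℝ, F) (components x₀ X) x :=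
  ((contMDiffOn_components x₀ X).contMDiffAt
    ((trivializationAt F E x₀).open_baseSet.mem_nhds h)).mdifferentiableAt (by simp)

theorem IsCutoffPoint.components_frame_eventuallyEq [FiniteDimensional ℝ B] [T2Space M]
    {x₀ x : M} (h : IsCutoffPoint (B := B) F E x₀ x) (Y : F) :
    components x₀ (frame (B := B) F E x₀ Y) =ᶠ[𝓝 x] fun _ => Y := by
  filter_upwards [h.cutoff_eq_one,
    (trivializationAt F E x₀).open_baseSet.mem_nhds h.mem_baseSet] with x' h1 h2
  rw [components, frame_apply, h1, one_smul, Trivialization.continuousLinearMapAt_symmL _ h2]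

/-! ### The functions $\iota_X+f\circ\pi$ on $E^*$ and their differentials. -/

section LinearFunctions

/-- The components of an element of the dual bundle in the preferred trivialization at `x₀`. -/
def dualComponents (x₀ : M) (z : DualBundle F E) : F →L[ℝ] ℝ :=
  (trivializationAt (F →L[ℝ] ℝ) (fun x : M => E x →L[ℝ] Trivial M ℝ x) x₀ z).2

theorem dualComponents_apply (x₀ : M) (z : DualBundle F E) (Y : F) :
    dualComponents x₀ z Y = z.snd ((trivializationAt F E x₀).symmL ℝ z.proj Y) :=
  trivializationAt_dual_snd_apply x₀ z Y

theorem dualComponents_continuousLinearMapAt {x₀ : M} {z : DualBundle F E}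
    (h : z.proj ∈ (trivializationAt F E x₀).baseSet) (v : E z.proj) :
    dualComponents x₀ z ((trivializationAt F E x₀).continuousLinearMapAt ℝ z.proj v) = z.snd v := by
  rw [dualComponents_apply, Trivialization.symmL_continuousLinearMapAt _ h]

theorem mem_baseSet_dual {x₀ x : M} :
    x ∈ (trivializationAt (F →L[ℝ] ℝ) (fun x : M => E x →L[ℝ] Trivial M ℝ x) x₀).baseSet ↔
      x ∈ (trivializationAt F E x₀).baseSet := by
  rw [hom_trivializationAt_baseSet]
  exact and_iff_left (mem_univ x)

theorem contMDiffAt_dualComponents {x₀ : M} {z : DualBundle F E}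
    (h : z.proj ∈ (trivializationAt F E x₀).baseSet) :
    ContMDiffAt (modelDual B F) 𝓘(ℝ, F →L[ℝ] ℝ) ∞ (dualComponents (E := E) x₀) z := by
  have he : z ∈ (trivializationAt (F →L[ℝ] ℝ)
      (fun x : M => E x →L[ℝ] Trivial M ℝ x) x₀).source :=
    (Trivialization.mem_source _).2 (mem_baseSet_dual.2 h)
  exact ((Trivialization.contMDiffAt_iff (n := ∞) (IB := 𝓘(ℝ, B)) he).1 contMDiffAt_id).2

/-- The chart of the dual bundle. -/
theorem extChartAt_dual_apply {z₀ z : DualBundle F E}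
    (h : z.proj ∈ (trivializationAt F E z₀.proj).baseSet) :
    extChartAt (modelDual B F) z₀ z =
      (extChartAt 𝓘(ℝ, B) z₀.proj z.proj, dualComponents z₀.proj z) :=
  extChartAt_totalSpace_apply (mem_baseSet_dual.2 h)

theorem mem_chartAt_dual_source {z₀ z : DualBundle F E}
    (h : z.proj ∈ (trivializationAt F E z₀.proj).baseSet)
    (h' : z.proj ∈ (chartAt B z₀.proj).source) :
    z ∈ (chartAt (ModelProd B (F →L[ℝ] ℝ)) z₀).source :=
  (mem_chartAt_totalSpace_source z₀ z).2 ⟨mem_baseSet_dual.2 h, h'⟩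

namespace SkewAlgebroid

theorem linearFunction_eq {x₀ : M} {z : DualBundle F E}
    (h : z.proj ∈ (trivializationAt F E x₀).baseSet) (X : ContMDiffSection 𝓘(ℝ, B) F ∞ E) :
    linearFunction X z = dualComponents x₀ z (components x₀ X z.proj) :=
  (dualComponents_continuousLinearMapAt h _).symm

theorem contMDiff_linearFunction (X : ContMDiffSection 𝓘(ℝ, B) F ∞ E) :
    ContMDiff (modelDual B F) 𝓘(ℝ, ℝ) ∞ (linearFunction X : DualBundle F E → ℝ) := by
  intro z
  have h0 := mem_baseSet_trivializationAt F E z.proj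
  have hp : ContMDiffAt (modelDual B F) 𝓘(ℝ, B) ∞ (fun z : DualBundle F E => z.proj) z :=
    contMDiffAt_proj _
  have h1 : ContMDiffAt (modelDual B F) 𝓘(ℝ, F) ∞
      (fun z' : DualBundle F E => components z.proj X z'.proj) z :=
    ((contMDiffOn_components z.proj X).contMDiffAt
      ((trivializationAt F E z.proj).open_baseSet.mem_nhds h0)).comp z hp
  refine ((contMDiffAt_dualComponents h0).clm_apply h1).congr_of_eventuallyEq ?_
  filter_upwards [hp.continuousAt.preimage_mem_nhds
    ((trivializationAt F E z.proj).open_baseSet.mem_nhds h0)] with z' hz'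
  exact linearFunction_eq hz' X

theorem mdifferentiableAt_linearFunction (X : ContMDiffSection 𝓘(ℝ, B) F ∞ E)
    (z : DualBundle F E) :
    MDifferentiableAt (modelDual B F) 𝓘(ℝ, ℝ) (linearFunction X) z :=
  (contMDiff_linearFunction X).mdifferentiableAt (by simp)

theorem mdifferentiableAt_linearFunction_add (X : ContMDiffSection 𝓘(ℝ, B) F ∞ E)
    {f : M → ℝ} {z : DualBundle F E} (hf : MDifferentiableAt 𝓘(ℝ, B) 𝓘(ℝ, ℝ) f z.proj) :
    MDifferentiableAt (modelDual B F) 𝓘(ℝ, ℝ)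
      (fun z : DualBundle F E => linearFunction X z + f z.proj) z :=
  (mdifferentiableAt_linearFunction X z).add (hf.comp z (mdifferentiableAt_proj _))

theorem eventually_comp_extChartAt_dual_symm {z₀ z : DualBundle F E}
    (h : z.proj ∈ (trivializationAt F E z₀.proj).baseSet)
    (h' : z.proj ∈ (chartAt B z₀.proj).source) (X : ContMDiffSection 𝓘(ℝ, B) F ∞ E) (f : M → ℝ) :
    (fun z : DualBundle F E => linearFunction X z + f z.proj) ∘ (extChartAt (modelDual B F) z₀).symm
      =ᶠ[𝓝 (extChartAt (modelDual B F) z₀ z)] fun p =>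
        p.2 ((components z₀.proj X ∘ (extChartAt 𝓘(ℝ, B) z₀.proj).symm) p.1) +
          (f ∘ (extChartAt 𝓘(ℝ, B) z₀.proj).symm) p.1 := by
  have hs : z ∈ (extChartAt (modelDual B F) z₀).source := by
    rw [extChartAt_source]; exact mem_chartAt_dual_source h h'
  filter_upwards [(isOpen_extChartAt_target (I := modelDual B F) z₀).mem_nhds
    ((extChartAt (modelDual B F) z₀).map_source hs)] with p hp
  rw [FiberBundle.extChartAt_target] at hp
  have hp1 := hp.1.2
  have hp2 := mem_baseSet_dual.1 hp1
  have hp3 := extChartAt_totalSpace_symm_apply (I := 𝓘(ℝ, B)) (v₀ := z₀) (p := p) hp1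
  rw [Function.comp_apply, hp3, linearFunction_eq (x₀ := z₀.proj) hp2]
  congr 2
  exact (congrFun (Trivialization.coe_linearMapAt_of_mem (R := ℝ) (trivializationAt (F →L[ℝ] ℝ)
    (fun x : M => E x →L[ℝ] Trivial M ℝ x) z₀.proj) hp1) _).symm.trans
      (Trivialization.continuousLinearMapAt_symmL (R := ℝ) (trivializationAt (F →L[ℝ] ℝ)
        (fun x : M => E x →L[ℝ] Trivial M ℝ x) z₀.proj) hp1 p.2)

/-- The differential of `ι_X + f ∘ π` in the induced coordinates. -/
theorem fderiv_linearFunction_add {z₀ z : DualBundle F E}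
    (h : z.proj ∈ (trivializationAt F E z₀.proj).baseSet)
    (h' : z.proj ∈ (chartAt B z₀.proj).source) (X : ContMDiffSection 𝓘(ℝ, B) F ∞ E) {f : M → ℝ}
    (hf : MDifferentiableAt 𝓘(ℝ, B) 𝓘(ℝ, ℝ) f z.proj) (w : B × (F →L[ℝ] ℝ)) :
    fderiv ℝ ((fun z : DualBundle F E => linearFunction X z + f z.proj) ∘
        (extChartAt (modelDual B F) z₀).symm) (extChartAt (modelDual B F) z₀ z) w =
      dualComponents z₀.proj z (fderiv ℝ (components z₀.proj X ∘ (extChartAt 𝓘(ℝ, B) z₀.proj).symm)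
          (extChartAt 𝓘(ℝ, B) z₀.proj z.proj) w.1) +
        w.2 (components z₀.proj X z.proj) +
        fderiv ℝ (f ∘ (extChartAt 𝓘(ℝ, B) z₀.proj).symm)
          (extChartAt 𝓘(ℝ, B) z₀.proj z.proj) w.1 := by
  have hX := differentiableAt_comp_extChartAt_symm h' (mdifferentiableAt_components h X)
  have hf' := differentiableAt_comp_extChartAt_symm h' hf
  rw [(eventually_comp_extChartAt_dual_symm h h' X f).fderiv_eq, extChartAt_dual_apply h]
  set ξ := extChartAt 𝓘(ℝ, B) z₀.proj z.proj with hξ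
  set ζ := dualComponents z₀.proj z
  have hf1 : HasFDerivAt (fun p : B × (F →L[ℝ] ℝ) => p.1) (ContinuousLinearMap.fst ℝ B (F →L[ℝ] ℝ))
      (ξ, ζ) := hasFDerivAt_fst
  have hf2 : HasFDerivAt (fun p : B × (F →L[ℝ] ℝ) => p.2) (ContinuousLinearMap.snd ℝ B (F →L[ℝ] ℝ))
      (ξ, ζ) := hasFDerivAt_snd
  have h1 := HasFDerivAt.comp (ξ, ζ) (f := fun p : B × (F →L[ℝ] ℝ) => p.1) hX.hasFDerivAt hf1
  have h2 := HasFDerivAt.comp (ξ, ζ) (f := fun p : B × (F →L[ℝ] ℝ) => p.1) hf'.hasFDerivAt hf1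
  have hXx : (components z₀.proj X ∘ (extChartAt 𝓘(ℝ, B) z₀.proj).symm) ξ =
      components z₀.proj X z.proj := by
    rw [Function.comp_apply, hξ, (extChartAt 𝓘(ℝ, B) z₀.proj).left_inv]
    rwa [extChartAt_source]
  have h3 := ((hf2.clm_apply h1).add h2).fderiv
  refine (DFunLike.congr_fun h3 w).trans ?_
  rw [← hXx]
  -- What remains is the product rule for the evaluation $(\xi,\zeta)\mapsto\zeta(X(\xi))$, plus the
  -- derivative of $f$.
  simp

end SkewAlgebroid

end LinearFunctions

/-! ### The bracket of sections in a trivialization. -/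

section BracketComponents

/-- Reflexivity of finite-dimensional spaces. It yields both the fibre coordinate of a covector on
$E^*$ and the vector representing $A\mapsto\langle X,\varepsilon(A)\rangle$. -/
theorem exists_eq_eval {F : Type*} [NormedAddCommGroup F] [NormedSpace ℝ F] [FiniteDimensional ℝ F]
    (Φ : (F →L[ℝ] ℝ) →ₗ[ℝ] ℝ) : ∃ y : F, ∀ δ : F →L[ℝ] ℝ, Φ δ = δ y := by
  refine ⟨(Module.evalEquiv ℝ F).symm
    (Φ ∘ₗ (LinearMap.toContinuousLinearMap (𝕜 := ℝ) (E := F) (F' := ℝ)).toLinearMap), fun δ => ?_⟩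
  have h := Module.apply_evalEquiv_symm_apply ℝ F (δ : F →ₗ[ℝ] ℝ)
    (Φ ∘ₗ (LinearMap.toContinuousLinearMap (𝕜 := ℝ) (E := F) (F' := ℝ)).toLinearMap)
  exact h.symm

/-- The derivative of the projection of a vector bundle in induced coordinates. -/
theorem mfderiv_totalSpace_proj {W H : Type*} [NormedAddCommGroup W] [NormedSpace ℝ W]
    [TopologicalSpace H] {I : ModelWithCorners ℝ W H} [I.Boundaryless] {Q : Type*}
    [TopologicalSpace Q] [ChartedSpace H Q] {F : Type*} [NormedAddCommGroup F] [NormedSpace ℝ F]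
    {E : Q → Type*} [∀ x, AddCommGroup (E x)] [∀ x, Module ℝ (E x)] [∀ x, TopologicalSpace (E x)]
    [TopologicalSpace (TotalSpace F E)] [FiberBundle F E] [VectorBundle ℝ F E]
    (v : TotalSpace F E) (w : W × F) :
    mfderiv (I.prod 𝓘(ℝ, F)) I (fun v : TotalSpace F E => v.proj) v w = w.1 := by
  have h : MDifferentiableAt (I.prod 𝓘(ℝ, F)) I (fun v : TotalSpace F E => v.proj) v :=
    mdifferentiableAt_proj _
  have h1 : writtenInExtChartAt (I.prod 𝓘(ℝ, F)) I v (fun v : TotalSpace F E => v.proj) =ᶠ[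
      𝓝 (extChartAt (I.prod 𝓘(ℝ, F)) v v)] fun p : W × F => p.1 := by
    filter_upwards [extChartAt_target_mem_nhds (I := I.prod 𝓘(ℝ, F)) v] with p hp
    rw [FiberBundle.extChartAt_target] at hp
    rw [writtenInExtChartAt, Function.comp_apply, Function.comp_apply,
      extChartAt_totalSpace_symm_apply hp.1.2]
    exact (extChartAt I v.proj).right_inv hp.1.1
  rw [h.mfderiv, (I.prod 𝓘(ℝ, F)).range_eq_univ, fderivWithin_univ, h1.fderiv_eq]
  exact DFunLike.congr_fun (hasFDerivAt_fst (𝕜 := ℝ) (E := W) (F := F)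
    (p := extChartAt (I.prod 𝓘(ℝ, F)) v v)).fderiv w

/-- The derivative of the components of a section at the centre of the preferred chart. -/
def componentsDeriv (x : M) (X : ContMDiffSection 𝓘(ℝ, B) F ∞ E) : B →L[ℝ] F :=
  fderiv ℝ (components x X ∘ (extChartAt 𝓘(ℝ, B) x).symm) (extChartAt 𝓘(ℝ, B) x x)

theorem mfderiv_components (x : M) (X : ContMDiffSection 𝓘(ℝ, B) F ∞ E) :
    mfderiv 𝓘(ℝ, B) 𝓘(ℝ, F) (components x X) x = componentsDeriv x X :=
  mfderiv_eq_fderiv_comp_extChartAt_symm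
    (mdifferentiableAt_components (mem_baseSet_trivializationAt F E x) X)

variable [FiniteDimensional ℝ B] [T2Space M]

theorem contMDiff_cutoff_smul {G : Type*} [NormedAddCommGroup G] [NormedSpace ℝ G] (x₀ : M)
    {g : M → G} (hg : ContMDiffOn 𝓘(ℝ, B) 𝓘(ℝ, G) ∞ g (trivializationAt F E x₀).baseSet) :
    ContMDiff 𝓘(ℝ, B) 𝓘(ℝ, G) ∞ fun x => cutoff (B := B) F E x₀ x • g x := by
  refine contMDiff_of_tsupport fun x hx => ?_
  have : x ∈ (trivializationAt F E x₀).baseSet :=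
    (exists_cutoff F E x₀).choose_spec (tsupport_smul_subset_left _ _ hx)
  exact (cutoff F E x₀).contMDiffAt.smul
    ((hg _ this).contMDiffAt ((trivializationAt F E x₀).open_baseSet.mem_nhds this))

variable (F E) in
theorem cutoff_eq_zero {x₀ x : M} (h : x ∉ (trivializationAt F E x₀).baseSet) :
    cutoff (B := B) F E x₀ x = 0 :=
  image_eq_zero_of_notMem_tsupport fun hx => h ((exists_cutoff F E x₀).choose_spec hx)

/-- The components of a section at a point depend linearly on the section. -/
def componentsHom (x₀ x : M) : ContMDiffSection 𝓘(ℝ, B) F ∞ E →ₗ[ℝ] F where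
  toFun X := components x₀ X x
  map_add' X Y := by simp [components]
  map_smul' c X := by simp [components]

theorem tangentLift_congr {f g : M → ℝ} {u : TangentBundle 𝓘(ℝ, B) M} (h : f =ᶠ[𝓝 u.proj] g) :
    tangentLift 𝓘(ℝ, B) f u = tangentLift 𝓘(ℝ, B) g u := by
  rw [tangentLift, h.mfderiv_eq]
  rfl

theorem frame_components (x : M) (X : ContMDiffSection 𝓘(ℝ, B) F ∞ E) :
    frame (B := B) F E x (components x X x) x = X x := by
  rw [(isCutoffPoint_self F E x).frame_eq,
    symmL_components (mem_baseSet_trivializationAt F E x)]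

namespace SkewAlgebroid

variable (𝔸 : SkewAlgebroid (B := B) F E) [FiniteDimensional ℝ F]

/-- The derivation property of the bracket, expressed in the preferred trivialization. -/
theorem components_bracket_right (X Y : ContMDiffSection 𝓘(ℝ, B) F ∞ E) (x : M) :
    components x (𝔸.bracket X Y) x =
      components x (𝔸.bracket X (frame F E x (components x Y x))) x +
        componentsDeriv x Y (𝔸.anchor x (X x)) := by
  classical
  let b := Module.finBasis ℝ F
  let χ : M → ℝ := cutoff (B := B) F E x
  have hχ : ∀ᶠ x' in 𝓝 x, χ x' = 1 := (isCutoffPoint_self F E x).cutoff_eq_one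
  have hχ1 : χ x = 1 := hχ.self_of_nhds
  let c : Fin (Module.finrank ℝ F) → F →L[ℝ] ℝ := fun i => (b.coord i).toContinuousLinearMap
  let h : Fin (Module.finrank ℝ F) → M → ℝ := fun i x' => χ x' • c i (components x Y x')
  have hh : ∀ i, ContMDiff 𝓘(ℝ, B) 𝓘(ℝ, ℝ) ∞ (h i) := fun i =>
    contMDiff_cutoff_smul (E := E) x
      ((c i).contDiff.contMDiff.comp_contMDiffOn (contMDiffOn_components x Y))
  have hχs : ContMDiff 𝓘(ℝ, B) 𝓘(ℝ, ℝ) ∞ (fun x' => χ x' * χ x') :=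
    (cutoff F E x).contMDiff.mul (cutoff F E x).contMDiff
  -- One factor of the cutoff makes the coefficients `h i` global, the other is built into the
  -- frame. Hence it is $\chi^2Y$, not $Y$, that is globally a combination of frame sections.
  let Z : ContMDiffSection 𝓘(ℝ, B) F ∞ E :=
    ⟨fun x' => (χ x' * χ x') • Y x', hχs.smul_section Y.contMDiff⟩
  let Zi : Fin (Module.finrank ℝ F) → ContMDiffSection 𝓘(ℝ, B) F ∞ E := fun i =>
    ⟨fun x' => h i x' • frame (B := B) F E x (b i) x',
      (hh i).smul_section (frame (B := B) F E x (b i)).contMDiff⟩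
  have hZ : Z = ∑ i, Zi i := by
    ext x'
    have e1 : (∑ i, Zi i) x' = ∑ i, Zi i x' :=
      (congrFun (map_sum (ContMDiffSection.coeAddHom 𝓘(ℝ, B) F ∞ E) Zi Finset.univ) x').trans
        (Finset.sum_apply x' _ _)
    rw [e1]
    change (χ x' * χ x') • Y x' = ∑ i, (χ x' • c i (components x Y x')) •
      (χ x' • (trivializationAt F E x).symmL ℝ x' (b i))
    by_cases hx' : x' ∈ (trivializationAt F E x).baseSet
    · conv_lhs => rw [← symmL_components hx' Y, ← b.sum_repr (components x Y x'), map_sum,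
        Finset.smul_sum]
      refine Finset.sum_congr rfl fun i _ => ?_
      rw [map_smul, smul_smul, smul_smul]
      congr 1
      simp only [c, LinearMap.coe_toContinuousLinearMap', Module.Basis.coord_apply, smul_eq_mul]
      ring
    · simp [χ, cutoff_eq_zero F E hx']
  -- Replacing $Y$ by $\chi^2Y$ does not change the bracket at $x$: there $\chi^2=1$, and its
  -- differential vanishes.
  have hL : 𝔸.bracket X Z x = 𝔸.bracket X Y x := by
    rw [𝔸.leibniz X Y Z _ hχs (fun _ => rfl) x, hχ1]
    have : tangentLift 𝓘(ℝ, B) (fun x' => χ x' * χ x') ⟨x, 𝔸.anchor x (X x)⟩ = 0 := by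
      rw [tangentLift_congr (g := fun _ => 1) (by
        filter_upwards [hχ] with x' hx'
        simp [hx'])]
      simp [tangentLift]
      rfl
    rw [this]
    simp
  have hi : ∀ i, 𝔸.bracket X (Zi i) x = c i (components x Y x) • 𝔸.bracket X (frame F E x (b i)) x +
      c i (componentsDeriv x Y (𝔸.anchor x (X x))) •
        frame (B := B) F E x (b i) x := by
    intro i
    rw [𝔸.leibniz X _ (Zi i) (h i) (hh i) (fun _ => rfl) x]
    congr 2
    · simp [h, hχ1]
    · rw [tangentLift_congr (g := c i ∘ components x Y) (by
        filter_upwards [hχ] with x' hx'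
        simp [h, hx'])]
      have h1 := mdifferentiableAt_components (mem_baseSet_trivializationAt F E x) Y
      rw [tangentLift, mfderiv_comp (I' := 𝓘(ℝ, F)) x (c i).differentiableAt.mdifferentiableAt h1,
        mfderiv_eq_fderiv, (c i).fderiv, mfderiv_components]
      rfl
  have hc : ∀ i, components x (𝔸.bracket X (Zi i)) x =
      c i (components x Y x) • components x (𝔸.bracket X (frame F E x (b i))) x +
      c i (componentsDeriv x Y (𝔸.anchor x (X x))) • b i := by
    intro i
    rw [components, hi, map_add, map_smul, map_smul]
    congr 2
    exact (isCutoffPoint_self F E x).components_frame_eventuallyEq (b i) |>.self_of_nhds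
  have hs : components x (𝔸.bracket X Z) x = ∑ i, components x (𝔸.bracket X (Zi i)) x := by
    rw [hZ, map_sum]
    exact map_sum (componentsHom x x) _ _
  have hb : ∀ y : F, ∑ i, c i y • b i = y := fun y => b.sum_repr y
  have hl : components x (𝔸.bracket X (frame F E x (components x Y x))) x =
      ∑ i, c i (components x Y x) • components x (𝔸.bracket X (frame F E x (b i))) x := by
    conv_lhs => rw [← hb (components x Y x), map_sum, map_sum]
    refine (map_sum (componentsHom x x) _ _).trans (Finset.sum_congr rfl fun i _ => ?_)
    rw [map_smul, map_smul]
    exact map_smul (componentsHom x x) _ _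
  rw [hl, components, ← hL, ← components, hs, Finset.sum_congr rfl fun i _ => hc i,
    Finset.sum_add_distrib, hb]

/-- The bracket of two sections in terms of the brackets of the sections of the frame. -/
theorem components_bracket (X Y : ContMDiffSection 𝓘(ℝ, B) F ∞ E) (x : M) :
    components x (𝔸.bracket X Y) x =
      components x (𝔸.bracket (frame F E x (components x X x))
          (frame F E x (components x Y x))) x +
        componentsDeriv x Y (𝔸.anchor x (X x)) -
        componentsDeriv x X (𝔸.anchor x (Y x)) := by
  have hn : ∀ X Y : ContMDiffSection 𝓘(ℝ, B) F ∞ E,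
      components x (𝔸.bracket X Y) x = -components x (𝔸.bracket Y X) x := fun X Y => by
    rw [𝔸.skew X Y]
    exact map_neg (componentsHom x x) _
  -- The right derivation rule is used in each slot, with skew-symmetry to exchange them. The frame
  -- section replacing $Y$ has the value $Y(x)$ at $x$, so the anchor term is that of $Y$.
  rw [components_bracket_right, hn X, components_bracket_right, hn (frame F E x (components x Y x)),
    frame_components]
  abel

end SkewAlgebroid

end BracketComponents

/-! ### Existence and uniqueness of the contraction with $\Pi$. -/

section Contraction

variable [FiniteDimensional ℝ B] [T2Space M] [FiniteDimensional ℝ F]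

namespace SkewAlgebroid

/-- The derivative of `ι_Y` in induced coordinates. -/
theorem tangentLift_linearFunction (Y : ContMDiffSection 𝓘(ℝ, B) F ∞ E) (z : DualBundle F E)
    (w : B × (F →L[ℝ] ℝ)) :
    tangentLift (modelDual B F) (linearFunction Y : DualBundle F E → ℝ) ⟨z, w⟩ =
      dualComponents z.proj z (componentsDeriv z.proj Y w.1) +
        w.2 (components z.proj Y z.proj) := by
  have h := fderiv_linearFunction_add (z₀ := z) (mem_baseSet_trivializationAt F E z.proj)
    (mem_chart_source B z.proj) Y (f := fun _ => 0) (mdifferentiableAt_const) w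
  have h0 : (fun z : DualBundle F E => linearFunction Y z + (fun _ : M => (0 : ℝ)) z.proj) =
    linearFunction Y := by ext; simp
  rw [h0] at h
  rw [tangentLift, mfderiv_eq_fderiv_comp_extChartAt_symm (mdifferentiableAt_linearFunction Y z)]
  refine h.trans ?_
  have h1 : fderiv ℝ ((fun _ : M => (0 : ℝ)) ∘ (extChartAt 𝓘(ℝ, B) z.proj).symm)
      (extChartAt 𝓘(ℝ, B) z.proj z.proj) = 0 := fderiv_const_apply _
  rw [h1]
  simp [componentsDeriv]

/-- The differential of `ι_X + f ∘ π` in induced coordinates. -/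
theorem differential_linearFunction_add_snd (X : ContMDiffSection 𝓘(ℝ, B) F ∞ E)
    (z : DualBundle F E) {f : M → ℝ} (hf : MDifferentiableAt 𝓘(ℝ, B) 𝓘(ℝ, ℝ) f z.proj)
    (w : B × (F →L[ℝ] ℝ)) :
    (differential (modelDual B F) (fun z : DualBundle F E => linearFunction X z + f z.proj) z).snd w =
      dualComponents z.proj z (componentsDeriv z.proj X w.1) +
        w.2 (components z.proj X z.proj) + tangentLift 𝓘(ℝ, B) f ⟨z.proj, w.1⟩ := by
  have h := fderiv_linearFunction_add (z₀ := z) (mem_baseSet_trivializationAt F E z.proj)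
    (mem_chart_source B z.proj) X hf w
  rw [tangentLift, mfderiv_eq_fderiv_comp_extChartAt_symm hf, differential,
    mfderiv_eq_fderiv_comp_extChartAt_symm (mdifferentiableAt_linearFunction_add X hf)]
  exact h

theorem tangentLift_cutoffLinear (x : M) (p : B →L[ℝ] ℝ) (v : B) :
    tangentLift 𝓘(ℝ, B) (cutoffLinear F E x p) ⟨x, v⟩ = p v := by
  have h : mfderiv 𝓘(ℝ, B) 𝓘(ℝ, ℝ) (fun x' => p (extChartAt 𝓘(ℝ, B) x x')) x = p := by
    have := mfderiv_comp (I' := 𝓘(ℝ, B)) x p.differentiableAt.mdifferentiableAt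
      (mdifferentiableAt_extChartAt (I := 𝓘(ℝ, B)) (mem_chart_source B x))
    rw [mfderiv_extChartAt_self, mfderiv_eq_fderiv, p.fderiv] at this
    exact this
  rw [tangentLift_congr ((isCutoffPoint_self F E x).cutoffLinear_eventuallyEq p)]
  exact DFunLike.congr_fun h v

/-- Frame sections have constant components near the point, so they contribute no derivative terms
to differentials or brackets. -/
theorem componentsDeriv_frame (x : M) (Y : F) :
    componentsDeriv (B := B) x (frame (B := B) F E x Y) = 0 := by
  rw [← mfderiv_components,
    ((isCutoffPoint_self F E x).components_frame_eventuallyEq Y).mfderiv_eq]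
  exact mfderiv_const

theorem components_frame_self (x : M) (Y : F) :
    components x (frame (B := B) F E x Y) x = Y :=
  ((isCutoffPoint_self F E x).components_frame_eventuallyEq Y).self_of_nhds

/-- A covector with components `(p, y)` is the differential of a function `ι_X + f ∘ π`. -/
theorem differential_frame_cutoffLinear (ψ : Cotangent (modelDual B F) (DualBundle F E))
    (p : B →L[ℝ] ℝ) (y : F) (hψ : ∀ w : B × (F →L[ℝ] ℝ), ψ.snd w = p w.1 + w.2 y) :
    differential (modelDual B F) (fun z : DualBundle F E => linearFunction
      (frame (B := B) F E ψ.proj.proj y) z + cutoffLinear F E ψ.proj.proj p z.proj) ψ.proj = ψ := by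
  obtain ⟨z, ψ⟩ := ψ
  refine congrArg (fun φ => (⟨z, φ⟩ : Cotangent (modelDual B F) (DualBundle F E)))
    (ContinuousLinearMap.ext fun w => ?_)
  refine (differential_linearFunction_add_snd _ z
    ((contMDiff_cutoffLinear z.proj p).mdifferentiableAt (by simp)) w).trans ?_
  refine Eq.trans ?_ (hψ w).symm
  rw [componentsDeriv_frame, components_frame_self]
  have := tangentLift_cutoffLinear (E := E) (F := F) z.proj p w.1
  rw [this]
  simp [add_comm]

theorem exists_covector_components (ψ : Cotangent (modelDual B F) (DualBundle F E)) :
    ∃ (p : B →L[ℝ] ℝ) (y : F), ∀ w : B × (F →L[ℝ] ℝ), ψ.snd w = p w.1 + w.2 y := by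
  let a : B × (F →L[ℝ] ℝ) →L[ℝ] ℝ := ψ.snd
  obtain ⟨y, hy⟩ := exists_eq_eval (a.comp (ContinuousLinearMap.inr ℝ B (F →L[ℝ] ℝ))).toLinearMap
  refine ⟨a.comp (ContinuousLinearMap.inl ℝ B (F →L[ℝ] ℝ)), y, fun w => ?_⟩
  rw [← hy]
  change a w = a (w.1, 0) + a (0, w.2)
  rw [← map_add]
  simp

variable (𝔸 : SkewAlgebroid (B := B) F E)

/-- The anchor of the sections of the frame at `x₀`. -/
def anchorFrame (x₀ x : M) : F →ₗ[ℝ] B where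
  toFun Y := 𝔸.anchor x (frame (B := B) F E x₀ Y x)
  map_add' Y Y' := by
    rw [map_add]
    exact (𝔸.anchor x).map_add _ _
  map_smul' c Y := by
    rw [map_smul]
    exact (𝔸.anchor x).map_smul _ _

/-- The brackets of the sections of the frame at `x₀`. -/
def bracketFrame (x₀ x : M) : F →ₗ[ℝ] F →ₗ[ℝ] E x where
  toFun y :=
    { toFun := fun Y => 𝔸.bracket (frame F E x₀ y) (frame F E x₀ Y) x
      map_add' := fun Y Y' => by simp
      map_smul' := fun c Y => by simp }
  map_add' y y' := by ext Y; simp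
  map_smul' c y := by ext Y; simp

/-- The components of the contraction with `Π` of a covector at `z` with components `(p, y)`. -/
def contraction (z : DualBundle F E) (p : B →L[ℝ] ℝ) (y : F) : B × (F →L[ℝ] ℝ) :=
  (𝔸.anchorFrame z.proj z.proj y,
    LinearMap.toContinuousLinearMap (z.snd.toLinearMap ∘ₗ 𝔸.bracketFrame z.proj z.proj y -
      p.toLinearMap ∘ₗ 𝔸.anchorFrame z.proj z.proj))

theorem contraction_snd_apply (z : DualBundle F E) (p : B →L[ℝ] ℝ) (y Y : F) :
    (𝔸.contraction z p y).2 Y =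
      linearFunction (𝔸.bracket (frame F E z.proj y) (frame F E z.proj Y)) z -
        p (𝔸.anchorFrame z.proj z.proj Y) := rfl

/-- Different pairs $(X,f)$ may represent the same covector. Equality of differentials forces
$X(x)=y$ and $df=p-z(DX)$. The term $z(DX(\rho(Y)))$ so introduced cancels the one coming from
$[X,Y]$, so the prescribed values depend on $(p,y)$ only. -/
theorem isContraction_contraction (ψ : Cotangent (modelDual B F) (DualBundle F E))
    (p : B →L[ℝ] ℝ) (y : F) (hψ : ∀ w : B × (F →L[ℝ] ℝ), ψ.snd w = p w.1 + w.2 y) :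
    𝔸.IsContraction ψ (𝔸.contraction ψ.proj p y) := by
  obtain ⟨z, ψ⟩ := ψ
  intro X f hf hX
  have hf' : MDifferentiableAt 𝓘(ℝ, B) 𝓘(ℝ, ℝ) f z.proj := hf.mdifferentiableAt (by simp)
  have hX' : ∀ w : B × (F →L[ℝ] ℝ), dualComponents z.proj z (componentsDeriv z.proj X w.1) +
      w.2 (components z.proj X z.proj) + tangentLift 𝓘(ℝ, B) f ⟨z.proj, w.1⟩ = p w.1 + w.2 y := by
    intro w
    rw [← differential_linearFunction_add_snd X z hf' w, ← hψ w]
    have h1 : ∀ A : Cotangent (modelDual B F) (DualBundle F E), A.proj = z →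
      A = ⟨z, ψ⟩ → (A.snd : B × (F →L[ℝ] ℝ) →L[ℝ] ℝ) w = (ψ : B × (F →L[ℝ] ℝ) →L[ℝ] ℝ) w := by
      rintro A - rfl; rfl
    exact h1 _ rfl hX
  have hz : ∀ v : E z.proj, ∃ Y : F, frame (B := B) F E z.proj Y z.proj = v := fun v =>
    ⟨_, (isCutoffPoint_self F E z.proj).frame_eq _ |>.trans
      (Trivialization.symmL_continuousLinearMapAt _ (mem_baseSet_trivializationAt F E z.proj) v)⟩
  -- Testing the two expressions for the covector on vectors $(0,\varphi)$ determines $X(x)$.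
  -- Testing on $(v,0)$ below determines $df$.
  have hy : components z.proj X z.proj = y := by
    refine (Module.forall_dual_apply_eq_zero_iff ℝ _).1 (?_ : ∀ φ : Module.Dual ℝ F,
      φ (components z.proj X z.proj - y) = 0) |> sub_eq_zero.1
    intro φ
    have h := hX' (0, φ.toContinuousLinearMap)
    have h0 : tangentLift 𝓘(ℝ, B) f ⟨z.proj, (0 : B)⟩ = 0 :=
      (mfderiv 𝓘(ℝ, B) 𝓘(ℝ, ℝ) f z.proj).map_zero
    simp only [map_zero, h0] at h
    simpa [sub_eq_zero] using h
  have hp : ∀ v : B, tangentLift 𝓘(ℝ, B) f ⟨z.proj, v⟩ =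
      p v - dualComponents z.proj z (componentsDeriv z.proj X v) := by
    intro v
    have h := hX' (v, 0)
    simp only [zero_apply] at h
    linarith
  constructor
  · refine (mfderiv_totalSpace_proj (I := 𝓘(ℝ, B)) z _).trans ?_
    change 𝔸.anchor z.proj (frame (B := B) F E z.proj y z.proj) = _
    rw [← hy, frame_components]
  · intro Y
    have h0 := mem_baseSet_trivializationAt F E z.proj
    have h1 : 𝔸.anchorFrame z.proj z.proj y = 𝔸.anchor z.proj (X z.proj) := by
      rw [← frame_components z.proj X, hy]
      rfl
    have h2 : 𝔸.anchorFrame z.proj z.proj (components z.proj Y z.proj) =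
        𝔸.anchor z.proj (Y z.proj) := congrArg (𝔸.anchor z.proj) (frame_components z.proj Y)
    refine (tangentLift_linearFunction Y z _).trans ?_
    refine Eq.trans ?_ (congrArg _ (hp _).symm)
    rw [linearFunction_eq h0, components_bracket, contraction_snd_apply, linearFunction_eq h0,
      hy, h2]
    have h3 : (𝔸.contraction z p y).1 = 𝔸.anchor z.proj (X z.proj) := h1
    rw [h3, map_sub, map_add]
    ring

/-- One pair $(X,f)$ representing the covector is enough. The condition on $T\pi$ fixes the base
component, and the derivatives of $\iota_Y$ for frame sections $Y$ fix the fibre component. -/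
theorem IsContraction.eq {ψ : Cotangent (modelDual B F) (DualBundle F E)}
    {w w' : TangentSpace (modelDual B F) ψ.proj} (hw : 𝔸.IsContraction ψ w)
    (hw' : 𝔸.IsContraction ψ w') : w = w' := by
  obtain ⟨p, y, hψ⟩ := exists_covector_components ψ
  have h := differential_frame_cutoffLinear ψ p y hψ
  obtain ⟨h1, h2⟩ := hw _ _ (contMDiff_cutoffLinear ψ.proj.proj p) h
  obtain ⟨h1', h2'⟩ := hw' _ _ (contMDiff_cutoffLinear ψ.proj.proj p) h
  have h4 := fun w => mfderiv_totalSpace_proj (I := 𝓘(ℝ, B)) ψ.proj w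
  refine Prod.ext (((h4 w).symm.trans h1).trans (h1'.symm.trans (h4 w'))) (ContinuousLinearMap.ext fun Y => ?_)
  have h3 := (h2 (frame F E ψ.proj.proj Y)).trans (h2' (frame F E ψ.proj.proj Y)).symm
  have e1 := tangentLift_linearFunction (frame F E ψ.proj.proj Y) ψ.proj w
  have e2 := tangentLift_linearFunction (frame F E ψ.proj.proj Y) ψ.proj w'
  rw [componentsDeriv_frame, components_frame_self] at e1 e2
  simp only [zero_apply, map_zero, zero_add] at e1 e2
  exact e1.symm.trans (h3.trans e2)

/-- Existence ensures that the choice defining `sharp` has the defining property. -/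
theorem isContraction_sharp (ψ : Cotangent (modelDual B F) (DualBundle F E)) :
    𝔸.IsContraction ψ (𝔸.sharp ψ).snd := by
  obtain ⟨p, y, hψ⟩ := exists_covector_components ψ
  exact Classical.epsilon_spec (p := 𝔸.IsContraction ψ)
    ⟨_, 𝔸.isContraction_contraction ψ p y hψ⟩

theorem sharp_eq {ψ : Cotangent (modelDual B F) (DualBundle F E)} {p : B →L[ℝ] ℝ} {y : F}
    (hψ : ∀ w : B × (F →L[ℝ] ℝ), ψ.snd w = p w.1 + w.2 y) :
    𝔸.sharp ψ = ⟨ψ.proj, 𝔸.contraction ψ.proj p y⟩ :=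
  congrArg (fun w => (⟨ψ.proj, w⟩ : TangentBundle (modelDual B F) (DualBundle F E)))
    (IsContraction.eq 𝔸 (𝔸.isContraction_sharp ψ) (𝔸.isContraction_contraction ψ p y hψ))

end SkewAlgebroid

end Contraction

/-! ### Smoothness of the contraction with $\Pi$. -/

section SmoothContraction

variable [FiniteDimensional ℝ B] [T2Space M] [FiniteDimensional ℝ F]

theorem IsCutoffPoint.fderiv_components_frame {x₀ x : M} (h : IsCutoffPoint (B := B) F E x₀ x)
    (Y : F) : fderiv ℝ (components x₀ (frame (B := B) F E x₀ Y) ∘ (extChartAt 𝓘(ℝ, B) x₀).symm)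
      (extChartAt 𝓘(ℝ, B) x₀ x) = 0 := by
  have hx : x ∈ (extChartAt 𝓘(ℝ, B) x₀).source := by rw [extChartAt_source]; exact h.mem_source
  have h1 := h.components_frame_eventuallyEq Y
  rw [← (extChartAt 𝓘(ℝ, B) x₀).left_inv hx] at h1
  have h2 := (continuousAt_extChartAt_symm'' ((extChartAt 𝓘(ℝ, B) x₀).map_source hx)).eventually h1
  exact (Filter.EventuallyEq.fderiv_eq (f := fun _ => Y) h2).trans (fderiv_const_apply _)

theorem IsCutoffPoint.fderiv_cutoffLinear {x₀ x : M} (h : IsCutoffPoint (B := B) F E x₀ x)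
    (p : B →L[ℝ] ℝ) : fderiv ℝ (cutoffLinear F E x₀ p ∘ (extChartAt 𝓘(ℝ, B) x₀).symm)
      (extChartAt 𝓘(ℝ, B) x₀ x) = p := by
  have hx : x ∈ (extChartAt 𝓘(ℝ, B) x₀).source := by rw [extChartAt_source]; exact h.mem_source
  have h1 := h.cutoffLinear_eventuallyEq p
  rw [← (extChartAt 𝓘(ℝ, B) x₀).left_inv hx] at h1
  have h2 := (continuousAt_extChartAt_symm'' ((extChartAt 𝓘(ℝ, B) x₀).map_source hx)).eventually h1
  have h3 : cutoffLinear F E x₀ p ∘ (extChartAt 𝓘(ℝ, B) x₀).symm =ᶠ[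
      𝓝 (extChartAt 𝓘(ℝ, B) x₀ x)] p := by
    filter_upwards [h2, extChartAt_target_mem_nhds' ((extChartAt 𝓘(ℝ, B) x₀).map_source hx)]
      with ξ h3 h4
    rw [Function.comp_apply, h3, (extChartAt 𝓘(ℝ, B) x₀).right_inv h4]
  rw [h3.fderiv_eq, p.fderiv]

namespace SkewAlgebroid

/-- The components of a covector at `z` in the induced coordinates of `T*E*` at `z₀`. -/
def covectorComponents (z₀ : DualBundle F E) (ψ : Cotangent (modelDual B F) (DualBundle F E)) :
    B × (F →L[ℝ] ℝ) →L[ℝ] ℝ :=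
  (trivializationAt (B × (F →L[ℝ] ℝ) →L[ℝ] ℝ) (fun z : DualBundle F E =>
    TangentSpace (modelDual B F) z →L[ℝ] Trivial (DualBundle F E) ℝ z) z₀ ψ).2

/-- The components of a vector at `z` in the induced coordinates of `TE*` at `z₀`. -/
def vectorComponents (z₀ : DualBundle F E) (w : TangentBundle (modelDual B F) (DualBundle F E)) :
    B × (F →L[ℝ] ℝ) :=
  (trivializationAt (B × (F →L[ℝ] ℝ)) (TangentSpace (modelDual B F)) z₀ w).2

/-- The covector components of `d(ι_X + f ∘ π)` at `z₀`. -/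
theorem covectorComponents_differential {z₀ z : DualBundle F E}
    (h : z.proj ∈ (trivializationAt F E z₀.proj).baseSet)
    (h' : z.proj ∈ (chartAt B z₀.proj).source) (X : ContMDiffSection 𝓘(ℝ, B) F ∞ E) {f : M → ℝ}
    (hf : MDifferentiableAt 𝓘(ℝ, B) 𝓘(ℝ, ℝ) f z.proj) (w : B × (F →L[ℝ] ℝ)) :
    covectorComponents z₀ (differential (modelDual B F)
      (fun z : DualBundle F E => linearFunction X z + f z.proj) z) w =
      dualComponents z₀.proj z (fderiv ℝ (components z₀.proj X ∘ (extChartAt 𝓘(ℝ, B) z₀.proj).symm)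
          (extChartAt 𝓘(ℝ, B) z₀.proj z.proj) w.1) +
        w.2 (components z₀.proj X z.proj) +
        fderiv ℝ (f ∘ (extChartAt 𝓘(ℝ, B) z₀.proj).symm)
          (extChartAt 𝓘(ℝ, B) z₀.proj z.proj) w.1 :=
  (DFunLike.congr_fun (trivializationAt_differential_snd (mem_chartAt_dual_source h h')
    (mdifferentiableAt_linearFunction_add X hf)) w).trans (fderiv_linearFunction_add h h' X hf w)

theorem eq_of_covectorComponents_eq {z₀ : DualBundle F E}
    {ψ ψ' : Cotangent (modelDual B F) (DualBundle F E)} (hp : ψ.proj = ψ'.proj)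
    (h : ψ.proj ∈ (chartAt (ModelProd B (F →L[ℝ] ℝ)) z₀).source)
    (hψ : covectorComponents z₀ ψ = covectorComponents z₀ ψ') : ψ = ψ' := by
  have hb : ψ.proj ∈ (trivializationAt (B × (F →L[ℝ] ℝ) →L[ℝ] ℝ) (fun z : DualBundle F E =>
    TangentSpace (modelDual B F) z →L[ℝ] Trivial (DualBundle F E) ℝ z) z₀).baseSet := by
    rw [mem_baseSet_dual, TangentBundle.trivializationAt_baseSet]
    exact h
  have h1 := (Trivialization.mem_source _).2 hb
  have h2 := (Trivialization.mem_source _).2 (hp ▸ hb)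
  refine (Trivialization.toOpenPartialHomeomorph _).injOn h1 h2 (Prod.ext ?_ hψ)
  exact (Trivialization.coe_fst _ h1).trans (hp.trans (Trivialization.coe_fst _ h2).symm)

/-- Here the frame and the chart stay centred at the fixed $z_0$ while the base point of the
covector moves. Smoothness has to be read off in one fixed chart. -/
theorem differential_frame_eq {z₀ : DualBundle F E}
    {ψ : Cotangent (modelDual B F) (DualBundle F E)}
    (h : IsCutoffPoint (B := B) F E z₀.proj ψ.proj.proj) {p : B →L[ℝ] ℝ} {y : F}
    (hψ : ∀ w, covectorComponents z₀ ψ w = p w.1 + w.2 y) :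
    differential (modelDual B F) (fun z : DualBundle F E => linearFunction
      (frame (B := B) F E z₀.proj y) z + cutoffLinear F E z₀.proj p z.proj) ψ.proj = ψ := by
  refine eq_of_covectorComponents_eq (z₀ := z₀) rfl
    (mem_chartAt_dual_source h.mem_baseSet h.mem_source) (ContinuousLinearMap.ext fun w => ?_)
  rw [covectorComponents_differential h.mem_baseSet h.mem_source _
    ((contMDiff_cutoffLinear z₀.proj p).mdifferentiableAt (by simp)), hψ,
    h.fderiv_components_frame, h.fderiv_cutoffLinear,
    (h.components_frame_eventuallyEq y).self_of_nhds]
  simp [add_comm]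

theorem vectorComponents_fst {z₀ : DualBundle F E}
    {w : TangentBundle (modelDual B F) (DualBundle F E)}
    (h : w.proj.proj ∈ (trivializationAt F E z₀.proj).baseSet)
    (h' : w.proj.proj ∈ (chartAt B z₀.proj).source) :
    (vectorComponents z₀ w).1 = (trivializationAt B (TangentSpace 𝓘(ℝ, B)) z₀.proj).continuousLinearMapAt
      ℝ w.proj.proj (mfderiv (modelDual B F) 𝓘(ℝ, B) (fun z : DualBundle F E => z.proj) w.proj
        w.snd) := by
  have hs := mem_chartAt_dual_source h h'
  have e1 : (fun z => (extChartAt (modelDual B F) z₀ z).1) =ᶠ[𝓝 w.proj]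
      (extChartAt 𝓘(ℝ, B) z₀.proj) ∘ fun z : DualBundle F E => z.proj := by
    have hc : ContinuousAt (fun z : DualBundle F E => z.proj) w.proj :=
      (FiberBundle.continuous_proj _ _).continuousAt
    filter_upwards [hc.preimage_mem_nhds
      ((trivializationAt F E z₀.proj).open_baseSet.mem_nhds h)] with z hz
    rw [extChartAt_dual_apply hz]
    rfl
  have e2 := mfderiv_comp (I' := 𝓘(ℝ, B)) w.proj
    (mdifferentiableAt_extChartAt (I := 𝓘(ℝ, B)) h')
    (mdifferentiableAt_proj (IB := 𝓘(ℝ, B)) _ (p := w.proj))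
  have e3 := mfderiv_comp (I' := 𝓘(ℝ, B × (F →L[ℝ] ℝ))) (g := fun p : B × (F →L[ℝ] ℝ) => p.1) w.proj
    differentiableAt_fst.mdifferentiableAt (mdifferentiableAt_extChartAt (I := modelDual B F) hs)
  have e4 := (DFunLike.congr_fun e3 w.snd).symm.trans
    ((DFunLike.congr_fun e1.mfderiv_eq w.snd).trans (DFunLike.congr_fun e2 w.snd))
  rw [mfderiv_eq_fderiv, fderiv_fst] at e4
  rw [vectorComponents, trivializationAt_tangent_snd hs]
  refine e4.trans ?_
  have e5 := TangentBundle.continuousLinearMapAt_trivializationAt (I := 𝓘(ℝ, B)) h'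
  exact (DFunLike.congr_fun e5 _).symm

/-- Near a cutoff point $\iota$ of a frame section is a linear fibre coordinate, so its derivative
reads off one fibre component of a tangent vector. -/
theorem vectorComponents_snd {z₀ : DualBundle F E}
    {w : TangentBundle (modelDual B F) (DualBundle F E)}
    (h : IsCutoffPoint (B := B) F E z₀.proj w.proj.proj) (Y : F) :
    (vectorComponents z₀ w).2 Y = tangentLift (modelDual B F)
      (linearFunction (frame (B := B) F E z₀.proj Y) : DualBundle F E → ℝ) w := by
  have hs := mem_chartAt_dual_source h.mem_baseSet h.mem_source
  have h0 : (fun z : DualBundle F E => linearFunction (frame (B := B) F E z₀.proj Y) z +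
    (fun _ : M => (0 : ℝ)) z.proj) = linearFunction (frame (B := B) F E z₀.proj Y) := by ext; simp
  have h1 := fderiv_linearFunction_add h.mem_baseSet h.mem_source (frame (B := B) F E z₀.proj Y)
    (f := fun _ => 0) mdifferentiableAt_const (vectorComponents z₀ w)
  have h2 : fderiv ℝ ((fun _ : M => (0 : ℝ)) ∘ (extChartAt 𝓘(ℝ, B) z₀.proj).symm)
      (extChartAt 𝓘(ℝ, B) z₀.proj w.proj.proj) = 0 := fderiv_const_apply _
  rw [h0, h2, h.fderiv_components_frame, (h.components_frame_eventuallyEq Y).self_of_nhds] at h1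
  rw [tangentLift_eq_fderiv hs (mdifferentiableAt_linearFunction _ _)]
  refine Eq.trans ?_ h1.symm
  simp

variable (𝔸 : SkewAlgebroid (B := B) F E)

/-- The components of the anchor of the sections of the frame at `x₀`. -/
def anchorComponents (x₀ x : M) : F →ₗ[ℝ] B :=
  ((trivializationAt B (TangentSpace 𝓘(ℝ, B)) x₀).continuousLinearMapAt ℝ x).toLinearMap ∘ₗ
    𝔸.anchorFrame x₀ x

theorem contMDiffAt_anchorComponents (x₀ : M) (Y : F) :
    ContMDiffAt 𝓘(ℝ, B) 𝓘(ℝ, B) ∞ (fun x => 𝔸.anchorComponents x₀ x Y) x₀ := by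
  have h1 : ContMDiff 𝓘(ℝ, B) 𝓘(ℝ, B).tangent ∞ fun x => (⟨x, 𝔸.anchor x
      (frame (B := B) F E x₀ Y x)⟩ : TangentBundle 𝓘(ℝ, B) M) :=
    𝔸.contMDiff_anchor.comp (frame (B := B) F E x₀ Y).contMDiff
  refine ((contMDiffAt_totalSpace.1 (h1 x₀)).2).congr_of_eventuallyEq ?_
  filter_upwards [(trivializationAt B (TangentSpace 𝓘(ℝ, B)) x₀).open_baseSet.mem_nhds
    (mem_baseSet_trivializationAt B (TangentSpace 𝓘(ℝ, B)) x₀)] with x hx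
  exact congrFun (Trivialization.coe_linearMapAt_of_mem (R := ℝ) _ hx) _

/-- The contraction with `Π` in the induced coordinates at a point `z₀`. -/
theorem vectorComponents_sharp {z₀ : DualBundle F E}
    {ψ : Cotangent (modelDual B F) (DualBundle F E)}
    (h : IsCutoffPoint (B := B) F E z₀.proj ψ.proj.proj) {p : B →L[ℝ] ℝ} {y : F}
    (hψ : ∀ w, covectorComponents z₀ ψ w = p w.1 + w.2 y) :
    (vectorComponents z₀ (𝔸.sharp ψ)).1 = 𝔸.anchorComponents z₀.proj ψ.proj.proj y ∧
    ∀ Y, (vectorComponents z₀ (𝔸.sharp ψ)).2 Y =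
      ψ.proj.snd (𝔸.bracketFrame z₀.proj ψ.proj.proj y Y) -
        p (𝔸.anchorComponents z₀.proj ψ.proj.proj Y) := by
  obtain ⟨h1, h2⟩ := 𝔸.isContraction_sharp ψ _ _ (contMDiff_cutoffLinear z₀.proj p)
    (differential_frame_eq h hψ)
  constructor
  · rw [vectorComponents_fst (w := 𝔸.sharp ψ) h.mem_baseSet h.mem_source]
    exact congrArg _ h1
  · intro Y
    rw [vectorComponents_snd (w := 𝔸.sharp ψ) h]
    refine (h2 _).trans (congrArg _ ?_)
    refine (tangentLift_eq_fderiv (u := ⟨ψ.proj.proj, _⟩) h.mem_source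
      ((contMDiff_cutoffLinear z₀.proj p).mdifferentiableAt (by simp))).trans ?_
    rw [h.fderiv_cutoffLinear]
    have hb : ψ.proj.proj ∈ (trivializationAt B (TangentSpace 𝓘(ℝ, B)) z₀.proj).baseSet := by
      simpa using h.mem_source
    exact congrArg p (congrFun (Trivialization.coe_linearMapAt_of_mem (R := ℝ) _ hb) _).symm

/-- The contraction with the bivector field `Π` is smooth. -/
theorem contMDiff_sharp : ContMDiff ((modelDual B F).prod 𝓘(ℝ, (B × (F →L[ℝ] ℝ)) →L[ℝ] ℝ))
    (modelDual B F).tangent ∞ 𝔸.sharp := by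
  intro ψ₀
  let b := Module.finBasis ℝ F
  let c : Fin (Module.finrank ℝ F) → F →L[ℝ] ℝ := fun i => (b.coord i).toContinuousLinearMap
  have hb : ∀ y : F, ∑ i, c i y • b i = y := fun y => b.sum_repr y
  have hc : ∀ δ : F →L[ℝ] ℝ, ∑ i, δ (b i) • c i = δ := fun δ => by
    ext y
    conv_rhs => rw [← hb y, map_sum]
    rw [sum_apply]
    exact Finset.sum_congr rfl fun i _ => by simp [mul_comm]
  set z₀ := ψ₀.proj
  let P : Cotangent (modelDual B F) (DualBundle F E) → B × (F →L[ℝ] ℝ) →L[ℝ] ℝ :=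
    covectorComponents z₀
  have hP : ContMDiffAt ((modelDual B F).prod 𝓘(ℝ, (B × (F →L[ℝ] ℝ)) →L[ℝ] ℝ))
      𝓘(ℝ, (B × (F →L[ℝ] ℝ)) →L[ℝ] ℝ) ∞ P ψ₀ :=
    (contMDiffAt_totalSpace.1 (contMDiffAt_id (x := ψ₀))).2
  have hz : ContMDiffAt ((modelDual B F).prod 𝓘(ℝ, (B × (F →L[ℝ] ℝ)) →L[ℝ] ℝ))
      (modelDual B F) ∞ (fun ψ : Cotangent (modelDual B F) (DualBundle F E) => ψ.proj) ψ₀ :=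
    contMDiffAt_proj _
  have hx : ContMDiffAt ((modelDual B F).prod 𝓘(ℝ, (B × (F →L[ℝ] ℝ)) →L[ℝ] ℝ))
      𝓘(ℝ, B) ∞ (fun ψ : Cotangent (modelDual B F) (DualBundle F E) => ψ.proj.proj) ψ₀ :=
    (contMDiffAt_proj _).comp ψ₀ hz
  have hR := fun Y => (𝔸.contMDiffAt_anchorComponents z₀.proj Y).comp ψ₀ hx
  have hC := fun i j => (contMDiff_linearFunction
    (𝔸.bracket (frame F E z₀.proj (b i)) (frame F E z₀.proj (b j)))).contMDiffAt.comp ψ₀ hz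
  refine contMDiffAt_totalSpace.2 ⟨hz, ?_⟩
  have hPi : ∀ i, ContMDiffAt ((modelDual B F).prod 𝓘(ℝ, (B × (F →L[ℝ] ℝ)) →L[ℝ] ℝ))
      𝓘(ℝ, ℝ) ∞ (fun ψ => P ψ (0, c i)) ψ₀ := fun i => hP.clm_apply contMDiffAt_const
  have hPR : ∀ j, ContMDiffAt ((modelDual B F).prod 𝓘(ℝ, (B × (F →L[ℝ] ℝ)) →L[ℝ] ℝ))
      𝓘(ℝ, ℝ) ∞ (fun ψ => P ψ (𝔸.anchorComponents z₀.proj ψ.proj.proj (b j), 0)) ψ₀ := fun j =>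
    hP.clm_apply ((hR (b j)).prodMk_space contMDiffAt_const)
  -- This is the coordinate formula for $\widetilde\Pi$ in a basis: $P\psi(0,c_i)$ is the $i$-th
  -- coordinate of $y$, the functions $\iota_{[b_i,b_j]}$ supply the bracket terms, and `hPR`
  -- supplies $p(\rho(b_j))$. Each ingredient is smooth.
  have hG := (ContMDiffAt.sum (t := Finset.univ)
    fun i _ => (hPi i).smul (hR (b i))).prodMk_space (ContMDiffAt.sum (t := Finset.univ) fun j _ =>
      ((ContMDiffAt.sum (t := Finset.univ) fun i _ => (hPi i).smul (hC i j)).sub (hPR j)).smul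
        (contMDiffAt_const (c := c j)))
  refine hG.congr_of_eventuallyEq ?_
  filter_upwards [hx.continuousAt.eventually
    (eventually_isCutoffPoint (B := B) F E z₀.proj)] with ψ hψ
  have hPψ : ∀ w : B × (F →L[ℝ] ℝ), covectorComponents z₀ ψ w =
      (P ψ).comp (ContinuousLinearMap.inl ℝ B (F →L[ℝ] ℝ)) w.1 +
        w.2 (∑ i, P ψ (0, c i) • b i) := fun w => by
    have e1 : w.2 (∑ i, P ψ (0, c i) • b i) = P ψ (0, w.2) := by
      conv_rhs => rw [← hc w.2]
      have : ((0 : B), ∑ i, w.2 (b i) • c i) = ∑ i, w.2 (b i) • ((0 : B), c i) := by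
        simp [Prod.ext_iff, Prod.fst_sum, Prod.snd_sum]
      rw [this, map_sum, map_sum]
      exact Finset.sum_congr rfl fun i _ => by
        rw [map_smul, map_smul, smul_eq_mul, smul_eq_mul, mul_comm]
    rw [e1]
    change P ψ w = P ψ (w.1, 0) + P ψ (0, w.2)
    rw [← map_add]
    simp
  obtain ⟨h1, h2⟩ := 𝔸.vectorComponents_sharp hψ hPψ
  refine Prod.ext (h1.trans ?_) ((hc _).symm.trans ?_)
  · simp
  · refine Finset.sum_congr rfl fun j _ => ?_
    refine congrArg (fun r : ℝ => r • c j) ((h2 (b j)).trans ?_)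
    refine congrArg₂ (fun r s : ℝ => r - s) ?_ rfl
    rw [map_sum, LinearMap.sum_apply, map_sum]
    refine Finset.sum_congr rfl fun i _ => ?_
    rw [map_smul, LinearMap.smul_apply, map_smul]
    rfl

end SkewAlgebroid

end SmoothContraction

/-! ### Derivatives of tangent lifts and along vertical vectors. -/

section TangentLiftDerivative

section SecondDerivative

variable {W H : Type*} [NormedAddCommGroup W] [NormedSpace ℝ W] [TopologicalSpace H]
  {I : ModelWithCorners ℝ W H} [I.Boundaryless] {Q : Type*} [TopologicalSpace Q] [ChartedSpace H Q]
  [IsManifold I ∞ Q]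

theorem contDiffAt_comp_extChartAt_symm {G : Type*} [NormedAddCommGroup G] [NormedSpace ℝ G]
    {f : Q → G} {q₀ q : Q} (hq : q ∈ (chartAt H q₀).source) (hf : ContMDiff I 𝓘(ℝ, G) ∞ f) :
    ContDiffAt ℝ ∞ (f ∘ (extChartAt I q₀).symm) (extChartAt I q₀ q) := by
  have hq' : q ∈ (extChartAt I q₀).source := by rwa [extChartAt_source]
  rw [← contMDiffAt_iff_contDiffAt]
  exact hf.contMDiffAt.comp _ ((contMDiffOn_extChartAt_symm q₀).contMDiffAt
    (extChartAt_target_mem_nhds' ((extChartAt I q₀).map_source hq')))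

theorem contDiffAt_fderiv_comp_extChartAt_symm {f : Q → ℝ} {q₀ q : Q}
    (hq : q ∈ (chartAt H q₀).source) (hf : ContMDiff I 𝓘(ℝ, ℝ) ∞ f) :
    ContDiffAt ℝ ∞ (fderiv ℝ (f ∘ (extChartAt I q₀).symm)) (extChartAt I q₀ q) :=
  (contDiffAt_comp_extChartAt_symm hq hf).fderiv_right (by simp)

theorem contMDiff_tangentLift {f : Q → ℝ} (hf : ContMDiff I 𝓘(ℝ, ℝ) ∞ f) :
    ContMDiff I.tangent 𝓘(ℝ, ℝ) ∞ (tangentLift I f) := by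
  intro u
  have hp : ContMDiffAt I.tangent I ∞ (fun u : TangentBundle I Q => u.proj) u := contMDiffAt_proj _
  have hs : ContMDiffAt I.tangent 𝓘(ℝ, W) ∞ (fun u' : TangentBundle I Q =>
      (trivializationAt W (TangentSpace I) u.proj u').2) u :=
    (contMDiffAt_totalSpace.1 (contMDiffAt_id (x := u))).2
  have h1 := (contDiffAt_fderiv_comp_extChartAt_symm (mem_chart_source H u.proj) hf).contMDiffAt
  have h2 := (contMDiffAt_extChartAt (n := ∞) (I := I) (x := u.proj)).comp u hp
  refine ((h1.comp u h2).clm_apply hs).congr_of_eventuallyEq ?_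
  filter_upwards [hp.continuousAt.preimage_mem_nhds
    ((chartAt H u.proj).open_source.mem_nhds (mem_chart_source H u.proj))] with u' hu'
  exact tangentLift_eq_fderiv hu' (hf.mdifferentiableAt (by simp))

/-- The differential of the tangent lift of a function in the induced coordinates. -/
theorem mfderiv_tangentLift {f : Q → ℝ} (hf : ContMDiff I 𝓘(ℝ, ℝ) ∞ f) (u : TangentBundle I Q)
    (δ : W × W) : mfderiv I.tangent 𝓘(ℝ, ℝ) (tangentLift I f) u δ =
      fderiv ℝ (fderiv ℝ (f ∘ (extChartAt I u.proj).symm)) (extChartAt I u.proj u.proj) δ.1 u.snd +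
        tangentLift I f ⟨u.proj, δ.2⟩ := by
  have hd : MDifferentiableAt I.tangent 𝓘(ℝ, ℝ) (tangentLift I f) u :=
    (contMDiff_tangentLift hf).mdifferentiableAt (by simp)
  have h0 : (trivializationAt W (TangentSpace I) u.proj u).2 = u.snd := by
    have : IsManifold I 1 Q := IsManifold.of_le (n := ∞) (by simp)
    rw [trivializationAt_tangent_snd (mem_chart_source H u.proj), mfderiv_extChartAt_self]
    rfl
  have hu : u.proj ∈ (trivializationAt W (TangentSpace I) u.proj).baseSet :=
    mem_baseSet_trivializationAt W (TangentSpace I) u.proj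
  -- In induced coordinates $d_Tf$ is $(\xi,w)\mapsto Df(\xi)w$. The product rule then produces a
  -- second-derivative term and a first-derivative term.
  have h1 : tangentLift I f ∘ (extChartAt I.tangent u).symm =ᶠ[𝓝 (extChartAt I.tangent u u)]
      fun p : W × W => fderiv ℝ (f ∘ (extChartAt I u.proj).symm) p.1 p.2 := by
    filter_upwards [extChartAt_target_mem_nhds (I := I.tangent) u] with p hp
    rw [FiberBundle.extChartAt_target] at hp
    have hp1 := hp.1.2
    have hp2 : (extChartAt I u.proj).symm p.1 ∈ (chartAt H u.proj).source := by
      rw [← extChartAt_source I]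
      exact (extChartAt I u.proj).map_target hp.1.1
    rw [Function.comp_apply, extChartAt_totalSpace_symm_apply hp1,
      tangentLift_eq_fderiv hp2 (hf.mdifferentiableAt (by simp)),
      (extChartAt I u.proj).right_inv hp.1.1]
    congr 1
    exact (congrFun (Trivialization.coe_linearMapAt_of_mem (R := ℝ) _ hp1) _).symm.trans
      (Trivialization.continuousLinearMapAt_symmL (R := ℝ) _ hp1 p.2)
  have hx : extChartAt I.tangent u u = (extChartAt I u.proj u.proj, u.snd) := by
    rw [extChartAt_totalSpace_apply hu, h0]
    rfl
  have hD : DifferentiableAt ℝ (fderiv ℝ (f ∘ (extChartAt I u.proj).symm))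
      (extChartAt I u.proj u.proj) :=
    (contDiffAt_fderiv_comp_extChartAt_symm (mem_chart_source H u.proj) hf).differentiableAt
      (by simp)
  rw [mfderiv_eq_fderiv_comp_extChartAt_symm hd, h1.fderiv_eq, hx]
  have hf1 : HasFDerivAt (fun p : W × W => p.1) (ContinuousLinearMap.fst ℝ W W)
    (extChartAt I u.proj u.proj, (u.snd : W)) := hasFDerivAt_fst
  have hf2 : HasFDerivAt (fun p : W × W => p.2) (ContinuousLinearMap.snd ℝ W W)
    (extChartAt I u.proj u.proj, (u.snd : W)) := hasFDerivAt_snd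
  have h2 := ((HasFDerivAt.comp (extChartAt I u.proj u.proj, (u.snd : W))
    (f := fun p : W × W => p.1) hD.hasFDerivAt hf1).clm_apply hf2).fderiv
  have h3 : tangentLift I f ⟨u.proj, δ.2⟩ = fderiv ℝ (f ∘ (extChartAt I u.proj).symm)
      (extChartAt I u.proj u.proj) δ.2 := DFunLike.congr_fun
    (mfderiv_eq_fderiv_comp_extChartAt_symm (hf.mdifferentiableAt (by simp))) δ.2
  exact (DFunLike.congr_fun h2 δ).trans
    ((add_comm _ _).trans (congrArg₂ (fun r s : ℝ => r + s) rfl h3.symm))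

end SecondDerivative

section Vertical

/-- The derivative of a function along a vertical vector. -/
theorem mfderiv_vertical {G : Type*} [NormedAddCommGroup G] [NormedSpace ℝ G]
    {f : TotalSpace F E → G} {v : TotalSpace F E} (hf : MDifferentiableAt (modelE B F) 𝓘(ℝ, G) f v)
    (e : E v.proj) :
    mfderiv (modelE B F) 𝓘(ℝ, G) f v
      ((0, (trivializationAt F E v.proj).continuousLinearMapAt ℝ v.proj e) : B × F) =
      deriv (fun s : ℝ => f ⟨v.proj, v.snd + s • e⟩) 0 := by
  have hb := mem_baseSet_trivializationAt F E v.proj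
  set y := (trivializationAt F E v.proj).continuousLinearMapAt ℝ v.proj e
  have h1 := differentiableAt_comp_extChartAt_symm (mem_chart_source (ModelProd B F) v) hf
  have hs : extChartAt (modelE B F) v v =
      (extChartAt 𝓘(ℝ, B) v.proj v.proj, (trivializationAt F E v.proj v).2) :=
    extChartAt_totalSpace_apply hb
  have h2 : HasDerivAt (fun s : ℝ => extChartAt (modelE B F) v v + s • ((0, y) : B × F))
      ((0, y) : B × F) 0 := by
    simpa using ((hasDerivAt_id (0 : ℝ)).smul_const ((0, y) : B × F)).const_add
      (extChartAt (modelE B F) v v)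
  -- The trivialization is linear on fibres, so the line $v+se$ in the fibre is a straight line in
  -- the chart.
  have h3 : (fun s : ℝ => f ⟨v.proj, v.snd + s • e⟩) = (f ∘ (extChartAt (modelE B F) v).symm) ∘
      fun s : ℝ => extChartAt (modelE B F) v v + s • ((0, y) : B × F) := by
    ext s
    have h4 : extChartAt (modelE B F) v v + s • ((0, y) : B × F) =
        extChartAt (modelE B F) v ⟨v.proj, v.snd + s • e⟩ := by
      rw [extChartAt_totalSpace_apply (v := ⟨v.proj, v.snd + s • e⟩) hb, hs]
      refine Prod.ext (by simp) ?_
      have h5 : ∀ e : E v.proj, (trivializationAt F E v.proj ⟨v.proj, e⟩).2 =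
          (trivializationAt F E v.proj).continuousLinearMapAt ℝ v.proj e := fun e =>
        (congrFun (Trivialization.coe_linearMapAt_of_mem (R := ℝ) _ hb) e).symm
      simp only [Prod.snd_add, Prod.smul_snd]
      rw [h5 v.snd, h5 (v.snd + s • e), map_add, map_smul]
    rw [Function.comp_apply, h4, Function.comp_apply, (extChartAt (modelE B F) v).left_inv]
    rw [extChartAt_source, mem_chartAt_totalSpace_source]
    exact ⟨hb, mem_chart_source B v.proj⟩
  rw [h3, mfderiv_eq_fderiv_comp_extChartAt_symm hf]
  have h6 : HasFDerivAt (f ∘ (extChartAt (modelE B F) v).symm)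
      (fderiv ℝ (f ∘ (extChartAt (modelE B F) v).symm) (extChartAt (modelE B F) v v))
      (extChartAt (modelE B F) v v + (0 : ℝ) • ((0, y) : B × F)) := by
    rw [zero_smul, add_zero]
    exact h1.hasFDerivAt
  have h7 := (HasFDerivAt.comp_hasDerivAt (0 : ℝ) h6 h2).deriv
  exact h7.symm

/-- Vertical vectors need only the linear transition between trivializations, because charts are
affine on fibres. No derivative of the transition functions enters. -/
theorem mfderiv_extChartAt_vertical {v₀ v : TotalSpace F E}
    (h : v.proj ∈ (trivializationAt F E v₀.proj).baseSet)
    (h' : v.proj ∈ (chartAt B v₀.proj).source) (e : E v.proj) :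
    mfderiv (modelE B F) 𝓘(ℝ, B × F) (extChartAt (modelE B F) v₀) v
      ((0, (trivializationAt F E v.proj).continuousLinearMapAt ℝ v.proj e) : B × F) =
      ((0, (trivializationAt F E v₀.proj).continuousLinearMapAt ℝ v.proj e) : B × F) := by
  have h1 : MDifferentiableAt (modelE B F) 𝓘(ℝ, B × F) (extChartAt (modelE B F) v₀) v :=
    mdifferentiableAt_extChartAt ((mem_chartAt_totalSpace_source v₀ v).2 ⟨h, h'⟩)
  refine (mfderiv_vertical h1 e).trans ?_
  have h5 : ∀ e : E v.proj, (trivializationAt F E v₀.proj ⟨v.proj, e⟩).2 =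
      (trivializationAt F E v₀.proj).continuousLinearMapAt ℝ v.proj e := fun e =>
    (congrFun (Trivialization.coe_linearMapAt_of_mem (R := ℝ) _ h) e).symm
  have h2 : (fun s : ℝ => extChartAt (modelE B F) v₀ ⟨v.proj, v.snd + s • e⟩) = fun s : ℝ =>
      (extChartAt 𝓘(ℝ, B) v₀.proj v.proj,
        (trivializationAt F E v₀.proj).continuousLinearMapAt ℝ v.proj v.snd +
          s • (trivializationAt F E v₀.proj).continuousLinearMapAt ℝ v.proj e) := by
    ext1 s
    rw [extChartAt_totalSpace_apply (v := ⟨v.proj, v.snd + s • e⟩) h, h5, map_add, map_smul]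
  have h3 : HasDerivAt (fun s : ℝ => extChartAt (modelE B F) v₀ ⟨v.proj, v.snd + s • e⟩)
      (0, (trivializationAt F E v₀.proj).continuousLinearMapAt ℝ v.proj e) 0 := by
    rw [h2]
    refine (hasDerivAt_const _ _).prodMk ?_
    simpa using ((hasDerivAt_id (0 : ℝ)).smul_const
      ((trivializationAt F E v₀.proj).continuousLinearMapAt ℝ v.proj e)).const_add
      ((trivializationAt F E v₀.proj).continuousLinearMapAt ℝ v.proj v.snd)
  exact h3.deriv

end Vertical

end TangentLiftDerivative

/-! ### The map $\mathcal R_E\circ dL$ in induced coordinates. -/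

section DualDifferential

/-- The chain rule for $\xi\mapsto(\xi,X(\xi))$ followed by $L$. It allows $\mathcal R_E\circ dL$ to
be recognized as the differential of $\iota_X-(L\circ X)\circ\pi$. -/
theorem fderiv_comp_section {L : TotalSpace F E → ℝ} (hL : ContMDiff (modelE B F) 𝓘(ℝ, ℝ) ∞ L)
    (v₀ : TotalSpace F E) {x : M} (h : x ∈ (trivializationAt F E v₀.proj).baseSet)
    (h' : x ∈ (chartAt B v₀.proj).source) (X : ContMDiffSection 𝓘(ℝ, B) F ∞ E) (a : B) :
    fderiv ℝ ((fun x => L ⟨x, X x⟩) ∘ (extChartAt 𝓘(ℝ, B) v₀.proj).symm)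
      (extChartAt 𝓘(ℝ, B) v₀.proj x) a =
      fderiv ℝ (L ∘ (extChartAt (modelE B F) v₀).symm) (extChartAt (modelE B F) v₀ ⟨x, X x⟩)
        (a, fderiv ℝ (components v₀.proj X ∘ (extChartAt 𝓘(ℝ, B) v₀.proj).symm)
          (extChartAt 𝓘(ℝ, B) v₀.proj x) a) := by
  have hs : x ∈ (extChartAt 𝓘(ℝ, B) v₀.proj).source := by rwa [extChartAt_source]
  have hv : (⟨x, X x⟩ : TotalSpace F E) ∈ (chartAt (ModelProd B F) v₀).source :=
    (mem_chartAt_totalSpace_source v₀ _).2 ⟨h, h'⟩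
  have hX := differentiableAt_comp_extChartAt_symm h' (mdifferentiableAt_components h X)
  have hℓ := differentiableAt_comp_extChartAt_symm (I := modelE B F) hv
    ((hL.mdifferentiableAt (x := ⟨x, X x⟩)) (by simp))
  have h1 : (fun x => L ⟨x, X x⟩) ∘ (extChartAt 𝓘(ℝ, B) v₀.proj).symm =ᶠ[
      𝓝 (extChartAt 𝓘(ℝ, B) v₀.proj x)] (L ∘ (extChartAt (modelE B F) v₀).symm) ∘ fun ξ =>
        (ξ, (components v₀.proj X ∘ (extChartAt 𝓘(ℝ, B) v₀.proj).symm) ξ) := by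
    have hc := (continuousAt_extChartAt_symm'' ((extChartAt 𝓘(ℝ, B) v₀.proj).map_source hs))
    have hb : (trivializationAt F E v₀.proj).baseSet ∈
        𝓝 ((extChartAt 𝓘(ℝ, B) v₀.proj).symm (extChartAt 𝓘(ℝ, B) v₀.proj x)) := by
      rw [(extChartAt 𝓘(ℝ, B) v₀.proj).left_inv hs]
      exact (trivializationAt F E v₀.proj).open_baseSet.mem_nhds h
    filter_upwards [hc.preimage_mem_nhds hb] with ξ hξ
    simp only [Function.comp_apply]
    rw [extChartAt_totalSpace_symm_apply
      (p := (ξ, components v₀.proj X ((extChartAt 𝓘(ℝ, B) v₀.proj).symm ξ))) hξ,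
      symmL_components hξ]
  have h2 : extChartAt (modelE B F) v₀ ⟨x, X x⟩ = (extChartAt 𝓘(ℝ, B) v₀.proj x,
      (components v₀.proj X ∘ (extChartAt 𝓘(ℝ, B) v₀.proj).symm)
        (extChartAt 𝓘(ℝ, B) v₀.proj x)) := by
    rw [extChartAt_totalSpace_apply (v := ⟨x, X x⟩) h, Function.comp_apply,
      (extChartAt 𝓘(ℝ, B) v₀.proj).left_inv hs]
    exact congrArg _ (congrFun (Trivialization.coe_linearMapAt_of_mem (R := ℝ) _ h) _).symm
  rw [h1.fderiv_eq]
  rw [h2] at hℓ ⊢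
  have h3 := (HasFDerivAt.comp (extChartAt 𝓘(ℝ, B) v₀.proj x) hℓ.hasFDerivAt
    ((hasFDerivAt_id _).prodMk hX.hasFDerivAt)).fderiv
  exact DFunLike.congr_fun h3 a

/-- The composition of the differential of `L` with the canonical isomorphism `T*E → T*E*`. -/
def dualDifferential (L : TotalSpace F E → ℝ) (v : TotalSpace F E) :
    Cotangent (modelDual B F) (DualBundle F E) := dualityE (differential (modelE B F) L v)

theorem dualDifferential_proj_snd (L : TotalSpace F E → ℝ) (v : TotalSpace F E) (e : E v.proj) :
    (dualDifferential (B := B) L v).proj.snd e = mfderiv (modelE B F) 𝓘(ℝ, ℝ) L v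
      ((0, (trivializationAt F E v.proj).continuousLinearMapAt ℝ v.proj e) : B × F) := rfl

theorem dualDifferential_snd (L : TotalSpace F E → ℝ) (v : TotalSpace F E)
    (w : B × (F →L[ℝ] ℝ)) :
    (dualDifferential (B := B) L v).snd w =
      -tangentLift (modelE B F) L ⟨v, ((w.1, 0) : B × F)⟩ + w.2 (fibreCoord v) := rfl

/-- The first components of `R_E ∘ dL` in induced coordinates. -/
theorem dualComponents_dualDifferential {L : TotalSpace F E → ℝ}
    (hL : ContMDiff (modelE B F) 𝓘(ℝ, ℝ) ∞ L) {v₀ v : TotalSpace F E}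
    (h : v.proj ∈ (trivializationAt F E v₀.proj).baseSet)
    (h' : v.proj ∈ (chartAt B v₀.proj).source) (Y : F) :
    dualComponents v₀.proj (dualDifferential (B := B) L v).proj Y =
      fderiv ℝ (L ∘ (extChartAt (modelE B F) v₀).symm) (extChartAt (modelE B F) v₀ v) (0, Y) := by
  have hv : v ∈ (chartAt (ModelProd B F) v₀).source :=
    (mem_chartAt_totalSpace_source v₀ _).2 ⟨h, h'⟩
  rw [dualComponents_apply]
  refine (dualDifferential_proj_snd L v _).trans ?_
  refine (mfderiv_apply_eq_fderiv hv (hL.mdifferentiableAt (by simp)) _).trans ?_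
  refine congrArg _ ((mfderiv_extChartAt_vertical h h' _).trans ?_)
  exact congrArg (fun y => ((0, y) : B × F)) (Trivialization.continuousLinearMapAt_symmL _ h Y)

variable [FiniteDimensional ℝ B] [T2Space M] [FiniteDimensional ℝ F]

open SkewAlgebroid

/-- `R_E ∘ dL` at a point of the image of a section `X` is the differential of
`ι_X - (L ∘ X) ∘ π`. -/
theorem dualDifferential_section {L : TotalSpace F E → ℝ}
    (hL : ContMDiff (modelE B F) 𝓘(ℝ, ℝ) ∞ L) (X : ContMDiffSection 𝓘(ℝ, B) F ∞ E) (x : M) :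
    differential (modelDual B F) (fun z : DualBundle F E => linearFunction X z +
      -L ⟨z.proj, X z.proj⟩) (dualDifferential (B := B) L ⟨x, X x⟩).proj =
        dualDifferential L ⟨x, X x⟩ := by
  let v : TotalSpace F E := ⟨x, X x⟩
  have hb := mem_baseSet_trivializationAt F E x
  have hf : ContMDiff 𝓘(ℝ, B) 𝓘(ℝ, ℝ) ∞ fun x => -L ⟨x, X x⟩ := (hL.comp X.contMDiff).neg
  have hf1 : MDifferentiableAt 𝓘(ℝ, B) 𝓘(ℝ, ℝ) (fun x => -L ⟨x, X x⟩) x :=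
    hf.mdifferentiableAt (by simp)
  have hL1 : MDifferentiableAt (modelE B F) 𝓘(ℝ, ℝ) L v := hL.mdifferentiableAt (by simp)
  refine congrArg (fun ψ => (⟨(dualDifferential (B := B) L v).proj, ψ⟩ :
    Cotangent (modelDual B F) (DualBundle F E))) (ContinuousLinearMap.ext fun w => ?_)
  refine (differential_linearFunction_add_snd X (dualDifferential (B := B) L v).proj hf1 w).trans ?_
  refine Eq.trans ?_ (dualDifferential_snd L v w).symm
  have hw : ∀ w : B × F, tangentLift (modelE B F) L ⟨v, w⟩ =
      fderiv ℝ (L ∘ (extChartAt (modelE B F) v).symm) (extChartAt (modelE B F) v v) w := fun w =>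
    DFunLike.congr_fun (mfderiv_eq_fderiv_comp_extChartAt_symm hL1) w
  have e1 : dualComponents x (dualDifferential (B := B) L v).proj (componentsDeriv x X w.1) =
      tangentLift (modelE B F) L ⟨v, ((0, componentsDeriv x X w.1) : B × F)⟩ :=
    (dualComponents_dualDifferential hL (v₀ := v) (v := v) hb (mem_chart_source B x) _).trans
      (hw _).symm
  have e2 : fibreCoord v = components x X x :=
    (congrFun (Trivialization.coe_linearMapAt_of_mem (R := ℝ) _ hb) _).symm
  have e3 : tangentLift 𝓘(ℝ, B) (fun x => -L ⟨x, X x⟩) ⟨x, w.1⟩ =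
      -tangentLift (modelE B F) L ⟨v, ((w.1, componentsDeriv x X w.1) : B × F)⟩ := by
    rw [hw]
    refine Eq.trans ?_ (congrArg Neg.neg
      (fderiv_comp_section hL v hb (mem_chart_source B x) X w.1))
    refine (DFunLike.congr_fun (mfderiv_eq_fderiv_comp_extChartAt_symm hf1) w.1).trans ?_
    have e4 : (fun x => -L ⟨x, X x⟩) ∘ (extChartAt 𝓘(ℝ, B) x).symm =
      -((fun x => L ⟨x, X x⟩) ∘ (extChartAt 𝓘(ℝ, B) x).symm) := rfl
    rw [e4, fderiv_neg]
    rfl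
  have e5 : tangentLift (modelE B F) L ⟨v, ((w.1, componentsDeriv x X w.1) : B × F)⟩ =
      tangentLift (modelE B F) L ⟨v, ((w.1, 0) : B × F)⟩ +
        tangentLift (modelE B F) L ⟨v, ((0, componentsDeriv x X w.1) : B × F)⟩ := by
    rw [hw, hw, hw, ← map_add]
    simp
  change dualComponents x (dualDifferential (B := B) L v).proj (componentsDeriv x X w.1) +
    w.2 (components x X x) + tangentLift 𝓘(ℝ, B) (fun x => -L ⟨x, X x⟩) ⟨x, w.1⟩ = _
  -- The vertical derivative of $L$ along $DX$ occurs once from $\iota_X$ and once, with opposite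
  -- sign, from $-L\circ X$. It cancels, leaving $-p$ and $y$.
  rw [e1, e2, e3, e5]
  ring

/-- The covector components of `R_E ∘ dL` in induced coordinates. -/
theorem covectorComponents_dualDifferential {L : TotalSpace F E → ℝ}
    (hL : ContMDiff (modelE B F) 𝓘(ℝ, ℝ) ∞ L) {v₀ v : TotalSpace F E}
    (h : IsCutoffPoint (B := B) F E v₀.proj v.proj) (w : B × (F →L[ℝ] ℝ)) :
    covectorComponents (dualDifferential (B := B) L v₀).proj (dualDifferential (B := B) L v) w =
      -fderiv ℝ (L ∘ (extChartAt (modelE B F) v₀).symm) (extChartAt (modelE B F) v₀ v) (w.1, 0) +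
        w.2 ((trivializationAt F E v₀.proj).continuousLinearMapAt ℝ v.proj v.snd) := by
  set y := (trivializationAt F E v₀.proj).continuousLinearMapAt ℝ v.proj v.snd with hy
  -- A section through $v$ that is constant in the trivialization at $v_0$ has no derivative terms,
  -- so the differential of $L\circ X$ reduces to the partial derivative of $L$ in the base
  -- direction.
  let X := frame (B := B) F E v₀.proj y
  have hX : X v.proj = v.snd :=
    (h.frame_eq y).trans (Trivialization.symmL_continuousLinearMapAt _ h.mem_baseSet _)
  have hv : (⟨v.proj, X v.proj⟩ : TotalSpace F E) = v := by rw [hX]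
  have hf : ContMDiff 𝓘(ℝ, B) 𝓘(ℝ, ℝ) ∞ fun x => -L ⟨x, X x⟩ := (hL.comp X.contMDiff).neg
  have h1 := dualDifferential_section hL X v.proj
  rw [hv] at h1
  rw [← h1]
  refine (covectorComponents_differential (z₀ := (dualDifferential (B := B) L v₀).proj)
    (z := (dualDifferential (B := B) L v).proj) h.mem_baseSet h.mem_source X
    (f := fun x => -L ⟨x, X x⟩) (hf.mdifferentiableAt (by simp)) w).trans ?_
  have h2 : fderiv ℝ (components v₀.proj X ∘ (extChartAt 𝓘(ℝ, B) v₀.proj).symm)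
      (extChartAt 𝓘(ℝ, B) v₀.proj v.proj) = 0 := h.fderiv_components_frame y
  have h3 : components v₀.proj X v.proj = y := (h.components_frame_eventuallyEq y).self_of_nhds
  have h4 := fderiv_comp_section hL v₀ h.mem_baseSet h.mem_source X w.1
  rw [h2, hv] at h4
  have e4 : (fun x => -L ⟨x, X x⟩) ∘ (extChartAt 𝓘(ℝ, B) v₀.proj).symm =
    -((fun x => L ⟨x, X x⟩) ∘ (extChartAt 𝓘(ℝ, B) v₀.proj).symm) := rfl
  change dualComponents v₀.proj _ (fderiv ℝ (components v₀.proj X ∘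
    (extChartAt 𝓘(ℝ, B) v₀.proj).symm) (extChartAt 𝓘(ℝ, B) v₀.proj v.proj) w.1) +
      w.2 (components v₀.proj X v.proj) + fderiv ℝ ((fun x => -L ⟨x, X x⟩) ∘
        (extChartAt 𝓘(ℝ, B) v₀.proj).symm) (extChartAt 𝓘(ℝ, B) v₀.proj v.proj) w.1 = _
  rw [h2, h3, e4, fderiv_neg, neg_apply, h4]
  simp [add_comm]

end DualDifferential

/-! ### The tangent map of $\mathcal R_E\circ dL$ and the differential of $d_TL$. -/

section TangentDualDifferential

/-- The restriction of a covector to vertical vectors, in coordinates. -/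
def verticalPart (B F : Type*) [NormedAddCommGroup B] [NormedSpace ℝ B] [NormedAddCommGroup F]
    [NormedSpace ℝ F] : (B × F →L[ℝ] ℝ) →L[ℝ] F →L[ℝ] ℝ :=
  (ContinuousLinearMap.compL ℝ F (B × F) ℝ).flip (ContinuousLinearMap.inr ℝ B F)

/-- The covector with components `(-p, y)`, for a covector with components `(p, z)` and `y : F`. -/
def dualCovector (B F : Type*) [NormedAddCommGroup B] [NormedSpace ℝ B] [NormedAddCommGroup F]
    [NormedSpace ℝ F] : (B × F →L[ℝ] ℝ) × F →L[ℝ] B × (F →L[ℝ] ℝ) →L[ℝ] ℝ :=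
  (-((ContinuousLinearMap.compL ℝ (B × (F →L[ℝ] ℝ)) (B × F) ℝ).flip
      ((ContinuousLinearMap.inl ℝ B F).comp (ContinuousLinearMap.fst ℝ B (F →L[ℝ] ℝ))))).coprod
    (((ContinuousLinearMap.compL ℝ (B × (F →L[ℝ] ℝ)) (F →L[ℝ] ℝ) ℝ).flip
      (ContinuousLinearMap.snd ℝ B (F →L[ℝ] ℝ))).comp (ContinuousLinearMap.apply ℝ ℝ))

theorem dualCovector_apply (A : B × F →L[ℝ] ℝ) (y : F) (w : B × (F →L[ℝ] ℝ)) :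
    dualCovector B F (A, y) w = -A (w.1, 0) + w.2 y := by
  simp [dualCovector]

/-- This is the shape of `dualDifferentialCoord`, with `D` the derivative of $L$ in coordinates. The
remaining operations are linear, so differentiating only replaces `D` by the second derivative of
$L$. -/
theorem hasFDerivAt_prod_clm {A V₁ V₂ G₁ G₂ : Type*} [NormedAddCommGroup A] [NormedSpace ℝ A]
    [NormedAddCommGroup V₁] [NormedSpace ℝ V₁] [NormedAddCommGroup V₂] [NormedSpace ℝ V₂]
    [NormedAddCommGroup G₁] [NormedSpace ℝ G₁] [NormedAddCommGroup G₂] [NormedSpace ℝ G₂]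
    (K₁ : A →L[ℝ] G₁) (K₂ : A × V₂ →L[ℝ] G₂) {D : V₁ × V₂ → A} {D' : V₁ × V₂ →L[ℝ] A}
    {q : V₁ × V₂} (h : HasFDerivAt D D' q) :
    HasFDerivAt (fun q => ((q.1, K₁ (D q)), K₂ (D q, q.2)))
      (((ContinuousLinearMap.fst ℝ V₁ V₂).prod (K₁.comp D')).prod
        (K₂.comp (D'.prod (ContinuousLinearMap.snd ℝ V₁ V₂)))) q :=
  (hasFDerivAt_fst.prodMk (K₁.hasFDerivAt.comp q h)).prodMk
    (K₂.hasFDerivAt.comp q (h.prodMk hasFDerivAt_snd))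

instance : NormedAddCommGroup (B × (F →L[ℝ] ℝ) →L[ℝ] ℝ) :=
  ContinuousLinearMap.toNormedAddCommGroup

instance : NormedSpace ℝ (B × (F →L[ℝ] ℝ) →L[ℝ] ℝ) := ContinuousLinearMap.toNormedSpace

variable [FiniteDimensional ℝ B] [T2Space M] [FiniteDimensional ℝ F]

open SkewAlgebroid

/-- `R_E ∘ dL` in induced coordinates at `v₀`, as a function of the coordinates on `E`. -/
def dualDifferentialCoord (L : TotalSpace F E → ℝ) (v₀ : TotalSpace F E) (q : B × F) :
    (B × (F →L[ℝ] ℝ)) × (B × (F →L[ℝ] ℝ) →L[ℝ] ℝ) :=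
  ((q.1, verticalPart B F (fderiv ℝ (L ∘ (extChartAt (modelE B F) v₀).symm) q)),
    dualCovector B F (fderiv ℝ (L ∘ (extChartAt (modelE B F) v₀).symm) q, q.2))

theorem dualComponents_dualDifferential_eq {L : TotalSpace F E → ℝ}
    (hL : ContMDiff (modelE B F) 𝓘(ℝ, ℝ) ∞ L) {v₀ v : TotalSpace F E}
    (h : IsCutoffPoint (B := B) F E v₀.proj v.proj) :
    dualComponents v₀.proj (dualDifferential (B := B) L v).proj =
      (dualDifferentialCoord L v₀ (extChartAt (modelE B F) v₀ v)).1.2 :=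
  ContinuousLinearMap.ext fun Y =>
    dualComponents_dualDifferential hL h.mem_baseSet h.mem_source Y

theorem covectorComponents_dualDifferential_eq {L : TotalSpace F E → ℝ}
    (hL : ContMDiff (modelE B F) 𝓘(ℝ, ℝ) ∞ L) {v₀ v : TotalSpace F E}
    (h : IsCutoffPoint (B := B) F E v₀.proj v.proj) :
    covectorComponents (dualDifferential (B := B) L v₀).proj (dualDifferential (B := B) L v) =
      (dualDifferentialCoord L v₀ (extChartAt (modelE B F) v₀ v)).2 := by
  refine ContinuousLinearMap.ext fun w => (covectorComponents_dualDifferential hL h w).trans ?_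
  rw [dualDifferentialCoord, dualCovector_apply, extChartAt_totalSpace_apply h.mem_baseSet]
  congr 2
  exact congrFun (Trivialization.coe_linearMapAt_of_mem (R := ℝ) _ h.mem_baseSet) _

theorem extChartAt_dualDifferential {L : TotalSpace F E → ℝ}
    (hL : ContMDiff (modelE B F) 𝓘(ℝ, ℝ) ∞ L) {v₀ v : TotalSpace F E}
    (h : IsCutoffPoint (B := B) F E v₀.proj v.proj) :
    extChartAt ((modelDual B F).prod 𝓘(ℝ, B × (F →L[ℝ] ℝ) →L[ℝ] ℝ))
      (dualDifferential (B := B) L v₀) (dualDifferential (B := B) L v) =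
      dualDifferentialCoord L v₀ (extChartAt (modelE B F) v₀ v) := by
  have hb : (dualDifferential (B := B) L v).proj ∈ (trivializationAt (B × (F →L[ℝ] ℝ) →L[ℝ] ℝ)
      (fun z : DualBundle F E => TangentSpace (modelDual B F) z →L[ℝ] Trivial (DualBundle F E) ℝ z)
      (dualDifferential (B := B) L v₀).proj).baseSet := by
    rw [mem_baseSet_dual, TangentBundle.trivializationAt_baseSet]
    exact mem_chartAt_dual_source h.mem_baseSet h.mem_source
  refine (extChartAt_totalSpace_apply hb).trans ?_
  refine Prod.ext ?_ (covectorComponents_dualDifferential_eq hL h)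
  refine (extChartAt_dual_apply (z₀ := (dualDifferential (B := B) L v₀).proj)
    (z := (dualDifferential (B := B) L v).proj) h.mem_baseSet).trans ?_
  refine Prod.ext ?_ (dualComponents_dualDifferential_eq hL h)
  rw [extChartAt_totalSpace_apply h.mem_baseSet]
  rfl

theorem hasFDerivAt_dualDifferentialCoord {L : TotalSpace F E → ℝ}
    (hL : ContMDiff (modelE B F) 𝓘(ℝ, ℝ) ∞ L) (v : TotalSpace F E) :
    HasFDerivAt (dualDifferentialCoord (B := B) L v)
      (((ContinuousLinearMap.fst ℝ B F).prod ((verticalPart B F).comp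
        (fderiv ℝ (fderiv ℝ (L ∘ (extChartAt (modelE B F) v).symm)) (extChartAt (modelE B F) v v)))).prod
        ((dualCovector B F).comp ((fderiv ℝ (fderiv ℝ (L ∘ (extChartAt (modelE B F) v).symm))
          (extChartAt (modelE B F) v v)).prod (ContinuousLinearMap.snd ℝ B F))))
      (extChartAt (modelE B F) v v) :=
  hasFDerivAt_prod_clm (verticalPart B F) (dualCovector B F)
    ((contDiffAt_fderiv_comp_extChartAt_symm (mem_chart_source (ModelProd B F) v)
      hL).differentiableAt (by simp)).hasFDerivAt

theorem mdifferentiableAt_dualDifferential {L : TotalSpace F E → ℝ}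
    (hL : ContMDiff (modelE B F) 𝓘(ℝ, ℝ) ∞ L) (v : TotalSpace F E) :
    MDifferentiableAt (modelE B F) ((modelDual B F).prod 𝓘(ℝ, B × (F →L[ℝ] ℝ) →L[ℝ] ℝ))
      (dualDifferential (B := B) L) v := by
  have hp : MDifferentiableAt (modelE B F) 𝓘(ℝ, B) (fun v : TotalSpace F E => v.proj) v :=
    mdifferentiableAt_proj _
  have hG := ((hasFDerivAt_dualDifferentialCoord hL v).differentiableAt.mdifferentiableAt).comp v
    (mdifferentiableAt_extChartAt (I := modelE B F) (mem_chart_source (ModelProd B F) v))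
  have hc := hp.continuousAt.eventually (eventually_isCutoffPoint (B := B) F E v.proj)
  have h1 : MDifferentiableAt (modelE B F) (modelDual B F)
      (fun v => (dualDifferential (B := B) L v).proj) v := by
    refine (mdifferentiableAt_totalSpace _ _).2 ⟨hp, ?_⟩
    have h2 := (((ContinuousLinearMap.snd ℝ B (F →L[ℝ] ℝ)).comp (ContinuousLinearMap.fst ℝ
      (B × (F →L[ℝ] ℝ)) (B × (F →L[ℝ] ℝ) →L[ℝ] ℝ))).differentiableAt.mdifferentiableAt).comp v hG
    refine h2.congr_of_eventuallyEq ?_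
    filter_upwards [hc] with v' hv'
    exact dualComponents_dualDifferential_eq hL hv'
  refine (mdifferentiableAt_totalSpace _ _).2 ⟨h1, ?_⟩
  have h2 := ((ContinuousLinearMap.snd ℝ (B × (F →L[ℝ] ℝ))
    (B × (F →L[ℝ] ℝ) →L[ℝ] ℝ)).differentiableAt.mdifferentiableAt).comp v hG
  refine h2.congr_of_eventuallyEq ?_
  filter_upwards [hc] with v' hv'
  exact covectorComponents_dualDifferential_eq hL hv'

theorem mfderiv_dualDifferential {L : TotalSpace F E → ℝ}
    (hL : ContMDiff (modelE B F) 𝓘(ℝ, ℝ) ∞ L) (v : TotalSpace F E) (w : B × F) :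
    mfderiv (modelE B F) ((modelDual B F).prod 𝓘(ℝ, B × (F →L[ℝ] ℝ) →L[ℝ] ℝ))
      (dualDifferential (B := B) L) v w =
      (((w.1, verticalPart B F (fderiv ℝ (fderiv ℝ (L ∘ (extChartAt (modelE B F) v).symm))
          (extChartAt (modelE B F) v v) w)),
        dualCovector B F (fderiv ℝ (fderiv ℝ (L ∘ (extChartAt (modelE B F) v).symm))
          (extChartAt (modelE B F) v v) w, w.2)) :
        (B × (F →L[ℝ] ℝ)) × (B × (F →L[ℝ] ℝ) →L[ℝ] ℝ)) := by
  have h1 : writtenInExtChartAt (modelE B F) ((modelDual B F).prod 𝓘(ℝ, B × (F →L[ℝ] ℝ) →L[ℝ] ℝ)) v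
      (dualDifferential (B := B) L) =ᶠ[𝓝 (extChartAt (modelE B F) v v)]
      dualDifferentialCoord (B := B) L v := by
    have hc : ContinuousAt (fun q => ((extChartAt (modelE B F) v).symm q).proj)
        (extChartAt (modelE B F) v v) :=
      (FiberBundle.continuous_proj F E).continuousAt.comp (continuousAt_extChartAt_symm v)
    have he : ∀ᶠ x in 𝓝 ((extChartAt (modelE B F) v).symm (extChartAt (modelE B F) v v)).proj,
        IsCutoffPoint (B := B) F E v.proj x := by
      rw [extChartAt_to_inv]
      exact eventually_isCutoffPoint F E v.proj
    filter_upwards [hc.eventually he, extChartAt_target_mem_nhds (I := modelE B F) v] with q h1 h2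
    refine (extChartAt_dualDifferential hL h1).trans ?_
    rw [(extChartAt (modelE B F) v).right_inv h2]
  rw [(mdifferentiableAt_dualDifferential hL v).mfderiv, (modelE B F).range_eq_univ,
    fderivWithin_univ, h1.fderiv_eq]
  exact DFunLike.congr_fun (hasFDerivAt_dualDifferentialCoord hL v).fderiv w

/-- Both isomorphisms merely permute blocks and change signs. The block $c'$ along $\delta\dot v$
determines the foot point in $T^*E^*$, and the block $c$ along $\delta v$ enters the tangent vector
there. -/
theorem alpha_symm_dualityTE (v : TotalSpace F E) (u : B × F)
    (a : (B × F) × (B × F) →L[ℝ] ℝ) {c c' : B × F →L[ℝ] ℝ} (hc : ∀ δ, a (δ, 0) = c δ)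
    (hc' : ∀ δ, a (0, δ) = c' δ) :
    (alpha (modelDual B F) (DualBundle F E)).symm (dualityTE
      (⟨(⟨v, u⟩ : TangentBundle (modelE B F) (TotalSpace F E)), a⟩ :
        Cotangent (modelE B F).tangent (TangentBundle (modelE B F) (TotalSpace F E)))) =
      ⟨dualityE ⟨v, c'⟩, (((u.1, verticalPart B F c), dualCovector B F (c, u.2)) :
        (B × (F →L[ℝ] ℝ)) × (B × (F →L[ℝ] ℝ) →L[ℝ] ℝ))⟩ := by
  obtain rfl : a.comp (ContinuousLinearMap.inl ℝ (B × F) (B × F)) = c :=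
    ContinuousLinearMap.ext hc
  obtain rfl : a.comp (ContinuousLinearMap.inr ℝ (B × F) (B × F)) = c' :=
    ContinuousLinearMap.ext hc'
  have h₁ : ∀ f g : B × (F →L[ℝ] ℝ) →L[ℝ] ℝ, (f.coprod g).comp (ContinuousLinearMap.inr ℝ
      (B × (F →L[ℝ] ℝ)) (B × (F →L[ℝ] ℝ))) = g := fun f g => by ext <;> simp
  have h₂ : ∀ f g : B × (F →L[ℝ] ℝ) →L[ℝ] ℝ, (f.coprod g).comp (ContinuousLinearMap.inl ℝ
      (B × (F →L[ℝ] ℝ)) (B × (F →L[ℝ] ℝ))) = f := fun f g => by ext <;> simp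
  have h₃ : ∀ (c : B × F →L[ℝ] ℝ) (y : F), (-(c.comp (ContinuousLinearMap.inl ℝ B F))).coprod
      (ContinuousLinearMap.apply ℝ ℝ y) = dualCovector B F (c, y) := fun c y =>
    ContinuousLinearMap.ext fun w => (dualCovector_apply c y w).symm
  let z : DualBundle F E := (dualityE (⟨v, a.comp (ContinuousLinearMap.inr ℝ (B × F) (B × F))⟩ :
    Cotangent (modelE B F) (TotalSpace F E))).proj
  exact congrArg₂ (fun q₁ q₂ : B × (F →L[ℝ] ℝ) →L[ℝ] ℝ => (⟨⟨z, q₁⟩,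
    (((u.1, verticalPart B F (a.comp (ContinuousLinearMap.inl ℝ (B × F) (B × F)))), q₂) :
      (B × (F →L[ℝ] ℝ)) × (B × (F →L[ℝ] ℝ) →L[ℝ] ℝ))⟩ : TangentBundle ((modelDual B F).prod
        𝓘(ℝ, B × (F →L[ℝ] ℝ) →L[ℝ] ℝ)) (Cotangent (modelDual B F) (DualBundle F E))))
    (h₁ _ _) ((h₂ _ _).trans (h₃ _ _))

/-- The tangent map of `R_E ∘ dL` corresponds to the differential of the tangent lift of `L`. -/
theorem tangentMap_dualDifferential {L : TotalSpace F E → ℝ}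
    (hL : ContMDiff (modelE B F) 𝓘(ℝ, ℝ) ∞ L) (u : TangentBundle (modelE B F) (TotalSpace F E)) :
    tangentMap (modelE B F) ((modelDual B F).prod 𝓘(ℝ, B × (F →L[ℝ] ℝ) →L[ℝ] ℝ))
      (dualDifferential (B := B) L) u =
      (alpha (modelDual B F) (DualBundle F E)).symm (dualityTE
        (differential (modelE B F).tangent (tangentLift (modelE B F) L) u)) := by
  obtain ⟨v, u⟩ := u
  have hu := mfderiv_tangentLift hL (⟨v, u⟩ : TangentBundle (modelE B F) (TotalSpace F E))
  -- The one analytic input. The tangent map differentiates $dL$ in the direction $u$ and evaluates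
  -- on $\delta$, whereas the differential of $d_TL$ differentiates in the direction $\delta$ and
  -- evaluates on $u$.
  have hsymm : ∀ w : B × F, fderiv ℝ (fderiv ℝ (L ∘ (extChartAt (modelE B F) v).symm))
      (extChartAt (modelE B F) v v) w u = fderiv ℝ (fderiv ℝ (L ∘ (extChartAt (modelE B F) v).symm))
      (extChartAt (modelE B F) v v) u w := fun w =>
    ((contDiffAt_comp_extChartAt_symm (mem_chart_source (ModelProd B F) v)
      hL).isSymmSndFDerivAt (by simpa using WithTop.coe_le_coe.2 (le_top : (2 : ℕ∞) ≤ ⊤))).eq w u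
  have h1 : ∀ δ : B × F, mfderiv (modelE B F).tangent 𝓘(ℝ, ℝ) (tangentLift (modelE B F) L)
      ⟨v, u⟩ ((0, δ) : (B × F) × (B × F)) = mfderiv (modelE B F) 𝓘(ℝ, ℝ) L v δ := fun δ => by
    refine (hu (0, δ)).trans ?_
    have h0 : fderiv ℝ (fderiv ℝ (L ∘ (extChartAt (modelE B F) v).symm))
      (extChartAt (modelE B F) v v) (0 : B × F) u = 0 := by rw [map_zero]; rfl
    exact (congrArg (· + _) h0).trans (zero_add _)
  have h2 : ∀ δ : B × F, mfderiv (modelE B F).tangent 𝓘(ℝ, ℝ) (tangentLift (modelE B F) L)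
      ⟨v, u⟩ ((δ, 0) : (B × F) × (B × F)) =
        fderiv ℝ (fderiv ℝ (L ∘ (extChartAt (modelE B F) v).symm))
          (extChartAt (modelE B F) v v) u δ := fun δ => by
    refine (hu (δ, 0)).trans ?_
    have h3 : tangentLift (modelE B F) L ⟨v, (0 : B × F)⟩ = 0 :=
      (mfderiv (modelE B F) 𝓘(ℝ, ℝ) L v).map_zero
    rw [h3, add_zero]
    exact hsymm δ
  refine Eq.trans ?_ (alpha_symm_dualityTE v u _ h2 h1).symm
  exact congrArg (fun w => (⟨dualDifferential (B := B) L v, w⟩ : TangentBundle ((modelDual B F).prod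
    𝓘(ℝ, B × (F →L[ℝ] ℝ) →L[ℝ] ℝ)) (Cotangent (modelDual B F) (DualBundle F E))))
    (mfderiv_dualDifferential hL v u)

end TangentDualDifferential

/-! ### Comparison of the two equations, and the admissible variation. -/

section EulerLagrangeEquation

variable [FiniteDimensional ℝ B] [T2Space M] [FiniteDimensional ℝ F]

namespace SkewAlgebroid

variable (𝔸 : SkewAlgebroid (B := B) F E) {L : TotalSpace F E → ℝ}

theorem mdifferentiableAt_tulczyjew (hL : ContMDiff (modelE B F) 𝓘(ℝ, ℝ) ∞ L)
    (v : TotalSpace F E) :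
    MDifferentiableAt (modelE B F) (modelDual B F).tangent (tulczyjew 𝔸.eps L) v := by
  have h := MDifferentiableAt.comp (I' := (modelDual B F).prod 𝓘(ℝ, B × (F →L[ℝ] ℝ) →L[ℝ] ℝ))
    (g := 𝔸.sharp) (f := dualDifferential (B := B) L) v
    (𝔸.contMDiff_sharp.mdifferentiableAt (by simp)) (mdifferentiableAt_dualDifferential hL v)
  exact h

/-- The tangent map of the Tulczyjew differential of `L` is the Tulczyjew differential of the
tangent lift of `L`, up to the canonical involution. -/
theorem kappa_tangentMap_tulczyjew (hL : ContMDiff (modelE B F) 𝓘(ℝ, ℝ) ∞ L)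
    (u : TangentBundle (modelE B F) (TotalSpace F E)) :
    kappa (modelDual B F) (DualBundle F E)
      (tangentMap (modelE B F) (modelDual B F).tangent (tulczyjew 𝔸.eps L) u) =
      tulczyjew 𝔸.liftEps (tangentLift (modelE B F) L) u := by
  have h1 := tangentMap_comp_at (I' := (modelDual B F).prod 𝓘(ℝ, B × (F →L[ℝ] ℝ) →L[ℝ] ℝ)) u
    (𝔸.contMDiff_sharp.mdifferentiableAt (x := dualDifferential (B := B) L u.proj) (by simp))
    (mdifferentiableAt_dualDifferential hL u.proj)
  -- After the chain rule and the identity for $T(\mathcal R_E\circ dL)$, the right-hand side is the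
  -- definition of $d_T\varepsilon\circ d(d_TL)$.
  exact congrArg (kappa (modelDual B F) (DualBundle F E))
    (h1.trans (congrArg _ (tangentMap_dualDifferential hL u)))

/-- The identity for $\Lambda_L$ is projected to $TE^*$. On $TTE^*$ the foot point of $\kappa(A)$ is
the image of $A$ under the tangent map of $TE^*\to E^*$. -/
theorem tangentMap_legendre (hL : ContMDiff (modelE B F) 𝓘(ℝ, ℝ) ∞ L)
    (u : TangentBundle (modelE B F) (TotalSpace F E)) :
    tangentMap (modelE B F) (modelDual B F) (legendre 𝔸.eps L) u =
      legendre 𝔸.liftEps (tangentLift (modelE B F) L) u := by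
  refine Eq.trans ?_ (congrArg TotalSpace.proj (𝔸.kappa_tangentMap_tulczyjew hL u))
  have h1 := tangentMap_comp_at (I' := (modelDual B F).tangent) (I'' := modelDual B F)
    (g := fun w : TangentBundle (modelDual B F) (DualBundle F E) => w.proj) u
    (mdifferentiableAt_proj _) (𝔸.mdifferentiableAt_tulczyjew hL u.proj)
  refine h1.trans ?_
  exact congrArg (fun w => (⟨(tulczyjew 𝔸.eps L u.proj).proj, w⟩ :
    TangentBundle (modelDual B F) (DualBundle F E)))
    (mfderiv_totalSpace_proj (I := modelDual B F) (tulczyjew 𝔸.eps L u.proj) _)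

/-- The tangent prolongation of the Euler-Lagrange equation of `(E, L)` is the Euler-Lagrange
equation of `(d_T E, d_T L)`. -/
theorem isProlongedELSolution_iff (hL : ContMDiff (modelE B F) 𝓘(ℝ, ℝ) ∞ L) (t₀ t₁ : ℝ)
    (J : ℝ → TangentBundle (modelE B F) (TotalSpace F E)) :
    IsProlongedELSolution 𝔸.eps L t₀ t₁ J ↔
      IsELSolution 𝔸.liftEps (tangentLift (modelE B F) L) t₀ t₁ J := by
  have h1 : (fun s => tangentMap (modelE B F) (modelDual B F) (legendre 𝔸.eps L) (J s)) =
      fun s => legendre 𝔸.liftEps (tangentLift (modelE B F) L) (J s) :=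
    funext fun s => 𝔸.tangentMap_legendre hL (J s)
  unfold IsProlongedELSolution IsELSolution
  rw [h1]
  exact forall₂_congr fun t _ => and_congr_right fun _ => by
    rw [𝔸.kappa_tangentMap_tulczyjew hL (J t)]

theorem eps_eq (v : TotalSpace F E) (A : B × F →L[ℝ] ℝ) :
    𝔸.eps ⟨v, A⟩ = ⟨(dualityE (B := B) (⟨v, A⟩ : Cotangent (modelE B F) (TotalSpace F E))).proj,
      𝔸.contraction (dualityE (B := B) (⟨v, A⟩ : Cotangent (modelE B F) (TotalSpace F E))).proj
        (-(A.comp (ContinuousLinearMap.inl ℝ B F))) (fibreCoord v)⟩ :=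
  𝔸.sharp_eq fun _ => rfl

/-- The trivialization used in `dualityE` to turn a form on $F$ into one on the fibre is undone by
the one used to read coordinates. -/
theorem dualCoord_dualityE (v : TotalSpace F E) (A : B × F →L[ℝ] ℝ) :
    dualCoord (dualityE (B := B) (⟨v, A⟩ : Cotangent (modelE B F) (TotalSpace F E))).proj =
      A.comp (ContinuousLinearMap.inr ℝ B F) := by
  ext Y
  refine (trivializationAt_dual_snd_apply v.proj _ Y).trans ?_
  exact congrArg (fun y => A (0, y)) (Trivialization.continuousLinearMapAt_symmL _
    (mem_baseSet_trivializationAt F E v.proj) Y)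

/-- The vector that represents the linear form `A ↦ ⟨X, ε(A)⟩`. -/
theorem existsUnique_tangentPairing_eps (v : TotalSpace F E)
    (X : TangentBundle (modelE B F) (TotalSpace F E)) :
    ∃! Y : TangentSpace (modelE B F) v, ∀ A : TangentSpace (modelE B F) v →L[ℝ] ℝ,
      tangentPairing X (𝔸.eps ⟨v, A⟩) = A Y := by
  let x : B × F := X.snd
  let y : F := fibreCoord v
  let y' : F := fibreCoord X.proj
  let T := (trivializationAt F E v.proj).continuousLinearMapAt ℝ v.proj
  -- The first term is $z\dot y$, the other two are $\dot z$ applied to $y'$. The anchor term has a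
  -- plus sign because $\mathcal R_E$ replaces $p$ by $-p$ and the contraction subtracts it. Every
  -- term is linear in $A$.
  let Φ : (B × F →L[ℝ] ℝ) →ₗ[ℝ] ℝ :=
    { toFun := fun A => A (0, x.2) +
        (A (0, T (𝔸.bracketFrame v.proj v.proj y y')) +
          A (𝔸.anchorFrame v.proj v.proj y', 0))
      map_add' := fun A A' => by simp only [add_apply]; ring
      map_smul' := fun c A => by simp only [smul_apply, smul_eq_mul, RingHom.id_apply]; ring }
  have hΦ : ∀ A : B × F →L[ℝ] ℝ, tangentPairing X (𝔸.eps ⟨v, A⟩) = Φ A := fun A => by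
    rw [eps_eq]
    change dualCoord _ x.2 + (𝔸.contraction _ _ _).2 y' = _
    rw [dualCoord_dualityE, contraction_snd_apply]
    refine congrArg₂ (· + ·) rfl ?_
    exact sub_neg_eq_add _ _
  obtain ⟨Y, hY⟩ := exists_eq_eval Φ
  refine ⟨Y, fun A => (hΦ A).trans (hY A), fun Y' hY' => ?_⟩
  have h : ∀ A : B × F →L[ℝ] ℝ, A Y' = A Y := fun A => ((hY' A).symm.trans (hΦ A)).trans (hY A)
  let Y₁ : B × F := Y'
  refine (sub_eq_zero (a := Y₁)).1 ((Module.forall_dual_apply_eq_zero_iff ℝ (Y₁ - Y)).1 fun φ => ?_)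
  exact (map_sub φ _ _).trans (sub_eq_zero.2 (h φ.toContinuousLinearMap))

theorem frame_fibreCoord (v : TotalSpace F E) :
    frame (B := B) F E v.proj (fibreCoord v) v.proj = v.snd := by
  have h := mem_baseSet_trivializationAt F E v.proj
  refine ((isCutoffPoint_self F E v.proj).frame_eq _).trans ?_
  rw [fibreCoord, ← congrFun (Trivialization.coe_linearMapAt_of_mem (R := ℝ) _ h) v.snd]
  exact Trivialization.symmL_continuousLinearMapAt _ h v.snd

/-- The base path of a solution of the Euler-Lagrange equation is integral for the anchor. -/
theorem rho_eq_velocity_of_isELSolution {t₀ t₁ : ℝ} (ht : t₀ < t₁) {γ : ℝ → TotalSpace F E}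
    (hγ : IsELSolution 𝔸.eps L t₀ t₁ γ) {t : ℝ} (h : t ∈ Icc t₀ t₁) :
    𝔸.rho (γ t) = velocity 𝓘(ℝ, B) (fun s => (γ s).proj) (Icc t₀ t₁) t := by
  obtain ⟨h1, h2⟩ := hγ t h
  have hu : UniqueMDiffWithinAt 𝓘(ℝ, ℝ) (Icc t₀ t₁) t :=
    (uniqueDiffOn_Icc ht t h).uniqueMDiffWithinAt
  have hp : MDifferentiableAt (modelDual B F) 𝓘(ℝ, B) (fun z : DualBundle F E => z.proj)
    (legendre 𝔸.eps L (γ t)) := mdifferentiableAt_proj _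
  have h3 := mfderiv_comp_mfderivWithin t hp h1 hu
  have h4 : mfderivWithin 𝓘(ℝ, ℝ) 𝓘(ℝ, B) (fun s => (γ s).proj) (Icc t₀ t₁) t (1 : ℝ) =
    mfderiv (modelDual B F) 𝓘(ℝ, B) (fun z : DualBundle F E => z.proj) (legendre 𝔸.eps L (γ t))
      (mfderivWithin 𝓘(ℝ, ℝ) (modelDual B F) (fun s => legendre 𝔸.eps L (γ s)) (Icc t₀ t₁) t
        (1 : ℝ)) := DFunLike.congr_fun h3 (1 : ℝ)
  -- Applying $T\pi$ to the EL equation turns its right-hand side into $\rho(\gamma(t))$ and its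
  -- left-hand side into the velocity of the base path.
  have h5 := congrArg (tangentMap (modelDual B F) 𝓘(ℝ, B) (fun z : DualBundle F E => z.proj)) h2
  refine Eq.trans ?_ (h5.symm.trans (congrArg (fun w => (⟨(γ t).proj, w⟩ :
    TangentBundle 𝓘(ℝ, B) M)) h4.symm))
  refine congrArg (fun w => (⟨(γ t).proj, w⟩ : TangentBundle 𝓘(ℝ, B) M)) ?_
  refine Eq.trans ?_ (mfderiv_totalSpace_proj (I := 𝓘(ℝ, B)) _ _).symm
  exact ((congrArg (fun w : TangentBundle (modelDual B F) (DualBundle F E) =>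
    (show B × (F →L[ℝ] ℝ) from w.snd).1) (𝔸.eps_eq (γ t) _)).trans
      (congrArg (𝔸.anchor (γ t).proj) (frame_fibreCoord (γ t)))).symm

/-- This is the anchor half of $\kappa$-relatedness. The base paths need agree only on the interval,
since all velocities are derivatives within it. -/
theorem rho_eq_tangentMap_velocity {t₀ t₁ : ℝ} (ht : t₀ < t₁) {γ η : ℝ → TotalSpace F E}
    (hγ : IsELSolution 𝔸.eps L t₀ t₁ γ) (hp : ∀ t ∈ Icc t₀ t₁, (η t).proj = (γ t).proj)
    (hη : MDifferentiableOn 𝓘(ℝ, ℝ) (modelE B F) η (Icc t₀ t₁)) {t : ℝ} (h : t ∈ Icc t₀ t₁) :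
    𝔸.rho (γ t) = tangentMap (modelE B F) 𝓘(ℝ, B) (fun v : TotalSpace F E => v.proj)
      (velocity (modelE B F) η (Icc t₀ t₁) t) := by
  have hu : UniqueMDiffWithinAt 𝓘(ℝ, ℝ) (Icc t₀ t₁) t :=
    (uniqueDiffOn_Icc ht t h).uniqueMDiffWithinAt
  have hπ : MDifferentiableAt (modelE B F) 𝓘(ℝ, B) (fun v : TotalSpace F E => v.proj) (η t) :=
    mdifferentiableAt_proj _
  have h1 : mfderivWithin 𝓘(ℝ, ℝ) 𝓘(ℝ, B) (fun s => (η s).proj) (Icc t₀ t₁) t (1 : ℝ) =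
    mfderiv (modelE B F) 𝓘(ℝ, B) (fun v : TotalSpace F E => v.proj) (η t)
      (mfderivWithin 𝓘(ℝ, ℝ) (modelE B F) η (Icc t₀ t₁) t (1 : ℝ)) :=
    DFunLike.congr_fun (mfderiv_comp_mfderivWithin t hπ (hη t h) hu) (1 : ℝ)
  have h2 : mfderivWithin 𝓘(ℝ, ℝ) 𝓘(ℝ, B) (fun s => (η s).proj) (Icc t₀ t₁) t (1 : ℝ) =
      mfderivWithin 𝓘(ℝ, ℝ) 𝓘(ℝ, B) (fun s => (γ s).proj) (Icc t₀ t₁) t (1 : ℝ) :=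
    congrArg (fun A : ℝ →L[ℝ] B => A 1) (mfderivWithin_congr (I := 𝓘(ℝ, ℝ)) (I' := 𝓘(ℝ, B))
      (f := fun s => (γ s).proj) (f₁ := fun s => (η s).proj) hp (hp t h))
  refine (𝔸.rho_eq_velocity_of_isELSolution ht hγ h).trans ?_
  exact congrArg₂ (fun (x : M) (w : B) => (⟨x, w⟩ : TangentBundle 𝓘(ℝ, B) M)) (hp t h).symm
    (h2.symm.trans h1)

/-- The admissible variation is the only vector field along `γ` that is `κ`-related to the
velocity of `η`. -/
theorem proj_eq_and_kappaRel_iff {t₀ t₁ : ℝ} (ht : t₀ < t₁) {γ η : ℝ → TotalSpace F E}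
    (hγ : IsELSolution 𝔸.eps L t₀ t₁ γ) (hp : ∀ t ∈ Icc t₀ t₁, (η t).proj = (γ t).proj)
    (hη : MDifferentiableOn 𝓘(ℝ, ℝ) (modelE B F) η (Icc t₀ t₁)) {t : ℝ} (h : t ∈ Icc t₀ t₁)
    (Y : TangentBundle (modelE B F) (TotalSpace F E)) :
    Y.proj = γ t ∧ 𝔸.KappaRel (velocity (modelE B F) η (Icc t₀ t₁) t) Y ↔
      Y = 𝔸.admissibleVariation (Icc t₀ t₁) γ η t := by
  obtain ⟨Z, hZ, hZ'⟩ := 𝔸.existsUnique_tangentPairing_eps (γ t)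
    (velocity (modelE B F) η (Icc t₀ t₁) t)
  have hs : 𝔸.KappaRel (velocity (modelE B F) η (Icc t₀ t₁) t)
      (𝔸.admissibleVariation (Icc t₀ t₁) γ η t) :=
    Classical.epsilon_spec (p := fun Y : TangentSpace (modelE B F) (γ t) =>
      𝔸.KappaRel (velocity (modelE B F) η (Icc t₀ t₁) t) ⟨γ t, Y⟩)
      ⟨Z, 𝔸.rho_eq_tangentMap_velocity ht hγ hp hη h, hZ⟩
  constructor
  · obtain ⟨v, Y⟩ := Y
    -- The anchor condition depends on $Y$ only through its foot point. Uniqueness comes entirely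
    -- from the pairing condition.
    rintro ⟨hv, -, hY⟩
    obtain rfl : v = γ t := hv
    exact congrArg (fun w => (⟨γ t, w⟩ : TangentBundle (modelE B F) (TotalSpace F E)))
      ((hZ' Y hY).trans (hZ' _ hs.2).symm)
  · rintro rfl
    exact ⟨rfl, hs⟩

end SkewAlgebroid

end EulerLagrangeEquation

end SkewAlg

end

theorem mainTheorem1 {B : Type*} [NormedAddCommGroup B] [NormedSpace ℝ B] [FiniteDimensional ℝ B]
    {M : Type*} [TopologicalSpace M] [T2Space M] [ChartedSpace B M] [IsManifold 𝓘(ℝ, B) ∞ M]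
    {F : Type*} [NormedAddCommGroup F] [NormedSpace ℝ F] [FiniteDimensional ℝ F]
    {E : M → Type*} [∀ x, AddCommGroup (E x)] [∀ x, Module ℝ (E x)] [∀ x, TopologicalSpace (E x)]
    [TopologicalSpace (TotalSpace F E)] [FiberBundle F E] [VectorBundle ℝ F E]
    [ContMDiffVectorBundle ∞ F E 𝓘(ℝ, B)]
    (𝔸 : SkewAlg.SkewAlgebroid F E)
    (L : TotalSpace F E → ℝ) (hL : ContMDiff (SkewAlg.modelE B F) 𝓘(ℝ, ℝ) ∞ L)
    (t₀ t₁ : ℝ) (ht : t₀ < t₁) :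
    (∀ J : ℝ → TangentBundle (SkewAlg.modelE B F) (TotalSpace F E),
      SkewAlg.IsProlongedELSolution 𝔸.eps L t₀ t₁ J ↔
        SkewAlg.IsELSolution 𝔸.liftEps (SkewAlg.tangentLift (SkewAlg.modelE B F) L) t₀ t₁ J) ∧
    ∀ γ : ℝ → TotalSpace F E, SkewAlg.IsELSolution 𝔸.eps L t₀ t₁ γ →
      ∀ η : ℝ → TotalSpace F E, (∀ t ∈ Icc t₀ t₁, (η t).proj = (γ t).proj) →
        MDifferentiableOn 𝓘(ℝ, ℝ) (SkewAlg.modelE B F) η (Icc t₀ t₁) →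
        (∀ t ∈ Icc t₀ t₁, ∀ Y : TangentBundle (SkewAlg.modelE B F) (TotalSpace F E),
          Y.proj = γ t ∧
              𝔸.KappaRel (SkewAlg.velocity (SkewAlg.modelE B F) η (Icc t₀ t₁) t) Y ↔
            Y = 𝔸.admissibleVariation (Icc t₀ t₁) γ η t) ∧
        (𝔸.IsJacobiField L t₀ t₁ γ η ↔
          SkewAlg.IsELSolution 𝔸.liftEps (SkewAlg.tangentLift (SkewAlg.modelE B F) L) t₀ t₁
            (𝔸.admissibleVariation (Icc t₀ t₁) γ η)) :=
  -- The conditions in `IsJacobiField` on the base path and the differentiability of $\eta$ are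
  -- among the hypotheses. The second equivalence is therefore the first one at
  -- $J=\delta_\eta\gamma$.
  ⟨fun J => 𝔸.isProlongedELSolution_iff hL t₀ t₁ J, fun _ hγ _ hp hη =>
    ⟨fun _ h Y => 𝔸.proj_eq_and_kappaRel_iff ht hγ hp hη h Y,
      ⟨fun h => (𝔸.isProlongedELSolution_iff hL t₀ t₁ _).1 h.2.2,
        fun h => ⟨hp, hη, (𝔸.isProlongedELSolution_iff hL t₀ t₁ _).2 h⟩⟩⟩⟩
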